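/- Let $q$ be a nonzero complex number that is not a root of unity (for instance $0<|q|<1$), fix a logarithm $w$ of $q$, and put $q^x=e^{xw}$ for $x\in\mathbb{Q}$. Let $(q)_n=\prod_{k=1}^{n}(1-q^k)$ for integers $n\ge 0$, and $$\begin{bmatrix} a\\ b\end{bmatrix}=\frac{(q)_a}{(q)_b\,(q)_{a-b}}\quad\text{if } b \text{ and } a-b \text{ are nonnegative integers},\qquad \begin{bmatrix} a\\ b\end{bmatrix}=0\quad\text{otherwise}.$$ For an integer $N\ge 1$ let $C$ be the Cartan matrix of $\mathrm{A}_{N-1}$, i.e. $C_{ij}=2\delta_{i,j}-\delta_{|i-j|,1}$ for $i,j=1,\dots,N-1$, let $\mathcal{I}=2I-C$, and let $e_1,\dots,e_{N-1}$ be the standard unit vectors of $\mathbb{Z}^{N-1}$. For $n\in\mathbb{Z}^{N-1}$ write $nC^{-1}n=\sum_{i,j}n_iC^{-1}_{ij}n_j$, and for $m,n\in\mathbb{Z}^{N-1}$ write $\begin{bmatrix} m+n\\ n\end{bmatrix}=\prod_{j=1}^{N-1}\begin{bmatrix} m_j+n_j\\ n_j\end{bmatrix}$. **Theorem.** Let $\sigma\in\{0,1\}$,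 let $N\ge 1$, $\ell$, $M$ be integers with $\ell+\sigma N$ even, and let $L_1,L_2\ge 0$ be such that $L_1+\frac{\ell+\sigma}{2}$ and $L_2+\frac{\ell+\sigma}{2}$ are integers. Then $$\sum_{i=0}^{M} q^{i(i+\ell)/N}\begin{bmatrix} L_1+L_2+M-i\\ M-i\end{bmatrix}\sum_{\substack{n\in\mathbb{Z}^{N-1}\\ \frac{2i+\ell+\sigma N}{2N}+(C^{-1}n)_1\in\mathbb{Z}}} q^{nC^{-1}n}\begin{bmatrix} m+n\\ n\end{bmatrix}\begin{bmatrix} L_1+\frac12 m_1\\ i+\ell\end{bmatrix}\begin{bmatrix} L_2+\frac12 m_1\\ i\end{bmatrix}$$ $$=\sum_{\substack{\eta\in\mathbb{Z}^{N-1}\\ \frac{\ell+\sigma N}{2N}+(C^{-1}\eta)_1\in\mathbb{Z}}} q^{\eta C^{-1}\eta}\begin{bmatrix} \mu+\eta\\ \eta\end{bmatrix}\begin{bmatrix} L_1+\frac12(M+\mu_1)\\ M+\ell\end{bmatrix}\begin{bmatrix} L_2+\frac12(M+\ell+\mu_{N-1})\\ M\end{bmatrix},$$ where the sum over $i$ is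 empty if $M<0$, and $m,\mu\in\mathbb{Z}^{N-1}$ are determined by $n$ and $\eta$ through $$m+n=\tfrac12\bigl(\mathcal{I}m+(2i+\ell)e_1\bigr),\qquad \mu+\eta=\tfrac12\bigl(\mathcal{I}\mu+(M+\ell)e_1+Me_{N-1}\bigr).$$ All sums over $n$ and over $\eta$ have only finitely many nonzero terms. For $N=1$ the sums over $n$ and $\eta$ have the single term of the empty vector, with $(C^{-1}n)_1=(C^{-1}\eta)_1=0$, $m_1=0$, $\mu_1=M$ and $\mu_{N-1}=\mu_0=M+\ell$, so that the formula is the classical $q$-Saalschütz sum $$\sum_{i=0}^M q^{i(i+\ell)}\begin{bmatrix} L_1+L_2+M-i\\ M-i\end{bmatrix}\begin{bmatrix} L_1\\ i+\ell\end{bmatrix}\begin{bmatrix} L_2\\ i\end{bmatrix}=\begin{bmatrix} L_1+M\\ M+\ell\end{bmatrix}\begin{bmatrix} L_2+M+\ell\\ M\end{bmatrix}.$$ -/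

import Mathlib

open scoped Matrix

noncomputable section

namespace QSaal

/-- The `q`-shifted factorial `(a; q)_n = ∏_{k < n} (1 - a q^k)` for `n ≥ 0`. -/
def qPoch (a q : ℂ) (n : ℕ) : ℂ := ∏ k ∈ Finset.range n, (1 - a * q ^ k)

/-- The `q`-binomial coefficient with top entry `a` and bottom entry `b`: it is
`(q)_a / ((q)_b (q)_{a-b})` if `b` and `a - b` are nonnegative integers, and `0` otherwise.
The entries are rational because the top entries in use are sums of half-integers. -/
def qBinom (q : ℂ) (a b : ℚ) : ℂ :=
  if a.den = 1 ∧ b.den = 1 ∧ 0 ≤ b ∧ b ≤ a then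
    qPoch q q ⌊a⌋.toNat / (qPoch q q ⌊b⌋.toNat * qPoch q q ⌊a - b⌋.toNat)
  else 0

/-- The power `q ^ x` for rational `x`, where `w` is a fixed logarithm of `q`. -/
def qPow (w : ℂ) (x : ℚ) : ℂ := Complex.exp ((x : ℂ) * w)

/-- The inverse of the Cartan matrix `C` of type `A_{N-1}`, over the rationals. -/
def cartanInv (N : ℕ) : Matrix (Fin (N - 1)) (Fin (N - 1)) ℚ :=
  ((CartanMatrix.A (N - 1)).map (fun z : ℤ => (z : ℚ)))⁻¹

/-- The incidence matrix `2 I - C` of type `A_{N-1}`. -/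
def incidence (N : ℕ) : Matrix (Fin (N - 1)) (Fin (N - 1)) ℤ :=
  2 • (1 : Matrix (Fin (N - 1)) (Fin (N - 1)) ℤ) - CartanMatrix.A (N - 1)

/-- The standard unit vector `e_j` of `ℤ^{N-1}`, `1 ≤ j ≤ N - 1` (position `k : Fin (N - 1)`
carries the label `k + 1`); it is zero for every other `j`. -/
def unitVec (N j : ℕ) : Fin (N - 1) → ℤ := fun k => if (k : ℕ) + 1 = j then 1 else 0

/-- The component `v_j` of `v ∈ ℤ^{N-1}` for `1 ≤ j ≤ N - 1`, extended by the boundary values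
`v_0 = left` and `v_N = right`. The extension is used only for `N = 1`. -/
def comp {N : ℕ} (left right : ℤ) (v : Fin (N - 1) → ℤ) (j : ℕ) : ℤ :=
  if j = 0 then left
  else if h : j - 1 < N - 1 then v ⟨j - 1, h⟩
  else right

/-- `(C⁻¹ n)_1 = e_1 C⁻¹ n`; this is `0` for `N = 1`. -/
def cartanInvFirst (N : ℕ) (n : Fin (N - 1) → ℤ) : ℚ :=
  (fun k => (unitVec N 1 k : ℚ)) ⬝ᵥ (cartanInv N *ᵥ fun k => (n k : ℚ))

/-- The quadratic form `n C⁻¹ n`. -/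
def cartanInvForm (N : ℕ) (n : Fin (N - 1) → ℤ) : ℚ :=
  (fun k => (n k : ℚ)) ⬝ᵥ (cartanInv N *ᵥ fun k => (n k : ℚ))

/-- The pairs `(m, n)` of vectors in `ℤ^{N-1}` solving the system `m + n = (𝓘 m + b) / 2` and
subject to the restriction `r + (C⁻¹ n)_1 ∈ ℤ`. As `C` is invertible, `n` determines `m`, so
that a sum over these pairs is a sum over `n`. -/
def solutions (N : ℕ) (b : Fin (N - 1) → ℤ) (r : ℚ) :
    Set ((Fin (N - 1) → ℤ) × (Fin (N - 1) → ℤ)) :=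
  {p | 2 • (p.1 + p.2) = incidence N *ᵥ p.1 + b ∧ ∃ k : ℤ, r + cartanInvFirst N p.2 = k}

/-- The index set of the inner sum on the left-hand side. -/
def lhsIndex (N : ℕ) (σ l i : ℤ) : Set ((Fin (N - 1) → ℤ) × (Fin (N - 1) → ℤ)) :=
  solutions N ((2 * i + l) • unitVec N 1) ((2 * i + l + σ * N : ℚ) / (2 * N))

/-- The index set of the sum on the right-hand side. -/
def rhsIndex (N : ℕ) (σ l M : ℤ) : Set ((Fin (N - 1) → ℤ) × (Fin (N - 1) → ℤ)) :=
  solutions N ((M + l) • unitVec N 1 + M • unitVec N (N - 1)) ((l + σ * N : ℚ) / (2 * N))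

/-- The product of the `q`-binomials with top `m_j + n_j` and bottom `n_j`, `1 ≤ j ≤ N - 1`. -/
def qBinomVec (q : ℂ) {N : ℕ} (m n : Fin (N - 1) → ℤ) : ℂ :=
  ∏ j, qBinom q (m j + n j) (n j)

/-- The summand of the inner sum on the left-hand side, where `m_1 = 0` if `N = 1`. -/
def lhsTerm (q w : ℂ) (N : ℕ) (l i : ℤ) (L₁ L₂ : ℚ)
    (p : (Fin (N - 1) → ℤ) × (Fin (N - 1) → ℤ)) : ℂ :=
  qPow w (cartanInvForm N p.2) * qBinomVec q p.1 p.2 *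
    qBinom q (L₁ + (comp (2 * i + l) 0 p.1 1 : ℚ) / 2) (i + l) *
    qBinom q (L₂ + (comp (2 * i + l) 0 p.1 1 : ℚ) / 2) i

/-- The summand of the sum on the right-hand side, for `p = (μ, η)`, where `μ_1 = M` and
`μ_{N-1} = μ_0 = M + l` if `N = 1`. -/
def rhsTerm (q w : ℂ) (N : ℕ) (l M : ℤ) (L₁ L₂ : ℚ)
    (p : (Fin (N - 1) → ℤ) × (Fin (N - 1) → ℤ)) : ℂ :=
  qPow w (cartanInvForm N p.2) * qBinomVec q p.1 p.2 *
    qBinom q (L₁ + (M + (comp (M + l) M p.1 1 : ℚ)) / 2) (M + l) *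
    qBinom q (L₂ + (M + l + (comp (M + l) M p.1 (N - 1) : ℚ)) / 2) M

end QSaal

end

/-! Write each summand as a chain of integers e_0, …, e_N whose interior is m (or μ) and whose end
values absorb the inhomogeneous term. The system says 2(m_k + n_k) = e_{k-1} + e_{k+1}, so by
symmetry each q-binomial becomes [(e_{k-1} + e_{k+1})/2; e_k]. Summation by parts gives n C⁻¹ n = Σ
(e_j - e_{j+1})²/4 - (e_N - e_0)²/(4N). The left-hand chains run from 2i + ℓ to 0, the right-hand
ones from M + ℓ to M. With Y = 2L₁ and X = 2L₂ + ℓ, the two extra q-binomials on the right have the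
same shape, with outer neighbours Y + M and X + M.

The two sides are connected by mixed chains: a left part ending in z, u, a right part starting with
u - 2k + M, v, and a product `link` of three q-binomials between them. The q-Saalschütz sum
(`gauss_saalschutz`) splits the right-hand closing factor into links with v = 0
(`halfGauss_saalschutz`). Two further Saalschütz sums (`link_exchange`) move the link one place to
the left. After N - 1 moves the left part is just (Y + M, M + ℓ), and with k = M - i the link is
exactly the product of the three explicit q-binomials on the left-hand side (`mixedSum_leftEnd`).

Saalschütz is used for all integer parameters, hence with the polynomial q-binomial, which need not
vanish at negative top entries. The mixed sums therefore carry an explicit inequality that removes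
spurious terms, and convexity of chains shows that the moves respect it (`mixedSum_step`). The
congruence restriction on n and η is automatic for nonzero terms, because the q-binomials containing
L₁ need integral top entries (`finsum_solutions`). -/

noncomputable section

namespace QSaal

/-! ### q-binomials with integer top entry: Pascal, q-Vandermonde, q-Saalschütz -/

/-- The polynomial `q`-binomial coefficient with arbitrary integer top entry. -/
def gaussNat (q : ℂ) (x : ℤ) (n : ℕ) : ℂ :=
  (∏ i ∈ Finset.range n, (1 - q ^ (x - i))) / qPoch q q n

theorem qPoch_succ (a q : ℂ) (n : ℕ) : qPoch a q (n + 1) = qPoch a q n * (1 - a * q ^ n) :=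
  Finset.prod_range_succ _ _

theorem one_sub_ne_zero_of_not_root {q : ℂ} (hq : ∀ k : ℕ, 0 < k → q ^ k ≠ 1) (n : ℕ) :
    1 - q * q ^ n ≠ 0 := by
  rw [← pow_succ']
  exact sub_ne_zero.2 (hq (n + 1) n.succ_pos).symm

theorem qPoch_ne_zero {q : ℂ} (hq : ∀ k : ℕ, 0 < k → q ^ k ≠ 1) (n : ℕ) : qPoch q q n ≠ 0 :=
  Finset.prod_ne_zero_iff.2 fun k _ => one_sub_ne_zero_of_not_root hq k

@[simp] theorem gaussNat_zero_right (q : ℂ) (x : ℤ) : gaussNat q x 0 = 1 := by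
  simp [gaussNat, qPoch]

/-- The factor with index i = x vanishes. For negative x there is no such factor, which is the
source of all later sign conditions. -/
theorem gaussNat_eq_zero {q : ℂ} {x : ℤ} {n : ℕ} (h0 : 0 ≤ x) (h : x < n) :
    gaussNat q x n = 0 := by
  rw [gaussNat, Finset.prod_eq_zero (i := x.toNat), zero_div]
  · simp only [Finset.mem_range]; omega
  · simp [h0]

/-- The numerator of `gaussNat` shifts along its top entry. -/
theorem prod_shift (q : ℂ) (x : ℤ) (n : ℕ) :
    ∏ i ∈ Finset.range (n + 1), (1 - q ^ (x + 1 - i)) =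
      (∏ i ∈ Finset.range n, (1 - q ^ (x - i))) * (1 - q ^ (x + 1)) := by
  rw [Finset.prod_range_succ']
  simp only [Nat.cast_zero, sub_zero]
  congr 1
  refine Finset.prod_congr rfl fun i _ => ?_
  rw [show x + 1 - ((i + 1 : ℕ) : ℤ) = x - i by push_cast; ring]

theorem gaussNat_pascal {q : ℂ} (h0 : q ≠ 0) (hq : ∀ k : ℕ, 0 < k → q ^ k ≠ 1) (x : ℤ) (n : ℕ) :
    gaussNat q (x + 1) (n + 1) = gaussNat q x (n + 1) + q ^ (x - n) * gaussNat q x n := by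
  have h1 := qPoch_ne_zero hq n
  have h2 := one_sub_ne_zero_of_not_root hq n
  simp only [gaussNat]
  rw [prod_shift, qPoch_succ, Finset.prod_range_succ]
  have h3 : q ^ (x + 1) = q ^ (x - n) * (q * q ^ n) := by
    rw [← pow_succ', ← zpow_natCast q (n + 1), ← zpow_add₀ h0]; congr 1; push_cast; ring
  rw [h3]
  field_simp
  ring

theorem prod_mul_qPoch (q : ℂ) (n k : ℕ) :
    (∏ i ∈ Finset.range k, (1 - q ^ ((n : ℤ) + k - i))) * qPoch q q n = qPoch q q (n + k) := by
  rw [qPoch, qPoch, Finset.prod_range_add, mul_comm,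
    ← Finset.prod_range_reflect (fun i : ℕ => 1 - q * q ^ (n + i)) k]
  congr 1
  refine Finset.prod_congr rfl fun i hi => ?_
  rw [Finset.mem_range] at hi
  rw [← pow_succ', ← zpow_natCast q]
  congr 2
  push_cast [show k - 1 - i = k - (1 + i) by omega, Nat.cast_sub (show 1 + i ≤ k by omega)]
  ring

theorem gaussNat_add {q : ℂ} (hq : ∀ k : ℕ, 0 < k → q ^ k ≠ 1) (n k : ℕ) :
    gaussNat q ((n : ℤ) + k) k = qPoch q q (n + k) / (qPoch q q n * qPoch q q k) := by
  have h1 := qPoch_ne_zero hq n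
  have h2 := qPoch_ne_zero hq k
  rw [gaussNat, ← prod_mul_qPoch]
  field_simp

/-- Trinomial revision: the two numerators on the left concatenate to the numerator of length n + k.
-/
theorem gaussNat_mul {q : ℂ} (hq : ∀ k : ℕ, 0 < k → q ^ k ≠ 1) (x : ℤ) (n k : ℕ) :
    gaussNat q x n * gaussNat q (x - n) k =
      gaussNat q x (n + k) * gaussNat q ((n : ℤ) + k) k := by
  have h1 := qPoch_ne_zero hq n
  have h2 := qPoch_ne_zero hq k
  have h3 := qPoch_ne_zero hq (n + k)
  rw [gaussNat_add hq, gaussNat, gaussNat, gaussNat, Finset.prod_range_add]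
  have : ∀ i : ℕ, x - ((n + i : ℕ) : ℤ) = x - n - i := fun i => by push_cast; ring
  simp only [this]
  field_simp

/-- The sum in the `q`-Vandermonde convolution. -/
def vandermondeSum (q : ℂ) (u v : ℤ) (n : ℕ) : ℂ :=
  ∑ p ∈ Finset.HasAntidiagonal.antidiagonal n,
    q ^ ((p.2 : ℤ) * (u - p.1)) * gaussNat q u p.1 * gaussNat q v p.2

theorem vandermondeSum_succ {q : ℂ} (h0 : q ≠ 0) (hq : ∀ k : ℕ, 0 < k → q ^ k ≠ 1) (u v : ℤ)
    (n : ℕ) :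
    vandermondeSum q u (v + 1) (n + 1) =
      vandermondeSum q u v (n + 1) + q ^ (u + v - n) * vandermondeSum q u v n := by
  simp only [vandermondeSum]
  rw [Finset.Nat.sum_antidiagonal_succ', Finset.Nat.sum_antidiagonal_succ', Finset.mul_sum, add_assoc,
    ← Finset.sum_add_distrib]
  simp only [gaussNat_zero_right]
  congr 1
  refine Finset.sum_congr rfl fun p hp => ?_
  have hp' : (n : ℤ) = p.1 + p.2 := by exact_mod_cast (Finset.HasAntidiagonal.mem_antidiagonal.1 hp).symm
  rw [gaussNat_pascal h0 hq]
  have h3 : q ^ (((p.2 + 1 : ℕ) : ℤ) * (u - p.1)) * q ^ (v - p.2) =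
      q ^ (u + v - n) * q ^ ((p.2 : ℤ) * (u - p.1)) := by
    rw [← zpow_add₀ h0, ← zpow_add₀ h0, hp']; congr 1; push_cast; ring
  linear_combination gaussNat q u p.1 * gaussNat q v p.2 * h3

/-- The `q`-Vandermonde convolution for arbitrary integer top entries. -/
theorem vandermondeSum_eq {q : ℂ} (h0 : q ≠ 0) (hq : ∀ k : ℕ, 0 < k → q ^ k ≠ 1) (u v : ℤ)
    (n : ℕ) : vandermondeSum q u v n = gaussNat q (u + v) n := by
  induction n generalizing v with
  | zero => simp [vandermondeSum]
  | succ n ih =>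
    -- Both sides satisfy the same recurrence in v, which can be run in either direction from v = 0,
    -- the lower-order term being known from the induction on n.
    induction v using Int.induction_on with
    | zero =>
      rw [vandermondeSum, Finset.Nat.sum_antidiagonal_succ', Finset.sum_eq_zero]
      · simp
      · intro p _
        rw [gaussNat_eq_zero (x := 0) le_rfl (by push_cast; omega), mul_zero]
    | succ v hv =>
      rw [vandermondeSum_succ h0 hq, hv, ih, ← add_assoc, gaussNat_pascal h0 hq]
    | pred v hv =>
      have h1 := vandermondeSum_succ h0 hq u (-(v : ℤ) - 1) n
      have h2 := gaussNat_pascal h0 hq (u + (-(v : ℤ) - 1)) n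
      rw [sub_add_cancel] at h1
      rw [show u + (-(v : ℤ) - 1) + 1 = u + -v by ring] at h2
      rw [hv, h2, ih] at h1
      exact (add_right_cancel h1).symm

/-- The polynomial `q`-binomial coefficient with integer entries. -/
def gauss (q : ℂ) (x n : ℤ) : ℂ := if 0 ≤ n then gaussNat q x n.toNat else 0

theorem gauss_of_neg (q : ℂ) (x : ℤ) {n : ℤ} (h : n < 0) : gauss q x n = 0 := if_neg (not_le.2 h)

@[simp] theorem gauss_natCast (q : ℂ) (x : ℤ) (n : ℕ) : gauss q x n = gaussNat q x n := by
  simp [gauss]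

theorem gauss_eq_zero {q : ℂ} {x n : ℤ} (h0 : 0 ≤ x) (h : x < n) : gauss q x n = 0 := by
  lift n to ℕ using h0.trans h.le
  rw [gauss_natCast, gaussNat_eq_zero h0 h]

@[simp] theorem gauss_zero_right (q : ℂ) (x : ℤ) : gauss q x 0 = 1 := by simp [gauss]

theorem gauss_symm {q : ℂ} (hq : ∀ k : ℕ, 0 < k → q ^ k ≠ 1) {a : ℤ} (ha : 0 ≤ a) (p : ℤ) :
    gauss q a (a - p) = gauss q a p := by
  rcases lt_or_ge p 0 with hp | hp
  · rw [gauss_of_neg q a hp, gauss_eq_zero ha (by omega)]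
  rcases lt_or_ge a p with hp' | hp'
  · rw [gauss_eq_zero ha hp', gauss_of_neg q a (by omega)]
  obtain ⟨b, rfl⟩ := Int.le.dest hp'
  lift p to ℕ using hp
  rw [show (p : ℤ) + b - p = b by ring, gauss_natCast, gauss_natCast, gaussNat_add hq,
    add_comm (p : ℤ), gaussNat_add hq, add_comm p, mul_comm (qPoch q q p)]

theorem gauss_mul {q : ℂ} (hq : ∀ k : ℕ, 0 < k → q ^ k ≠ 1) (x n k : ℤ) :
    gauss q x n * gauss q (x - n) k = gauss q x (n + k) * gauss q (n + k) k := by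
  rcases lt_or_ge k 0 with hk | hk
  · simp [gauss_of_neg _ _ hk]
  rcases lt_or_ge n 0 with hn | hn
  · rw [gauss_of_neg _ _ hn, zero_mul]
    rcases lt_or_ge (n + k) 0 with h | h
    · rw [gauss_of_neg _ _ h, zero_mul]
    · rw [gauss_eq_zero h (by omega), mul_zero]
  lift k to ℕ using hk
  lift n to ℕ using hn
  rw [← Nat.cast_add]
  simp only [gauss_natCast]
  rw [gaussNat_mul hq, Nat.cast_add]

/-- The `q`-Vandermonde convolution, summed over any interval containing the support. -/
theorem gauss_add_eq_sum {q : ℂ} (h0 : q ≠ 0) (hq : ∀ k : ℕ, 0 < k → q ^ k ≠ 1) (u v n p : ℤ)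
    {A B : ℤ} (hA : A ≤ p) (hB : p + n ≤ B) :
    gauss q (u + v) n = ∑ t ∈ Finset.Icc A B,
      q ^ ((n - (t - p)) * (u - (t - p))) * gauss q u (t - p) * gauss q v (n - (t - p)) := by
  rcases lt_or_ge n 0 with hn | hn
  · rw [gauss_of_neg _ _ hn, Finset.sum_eq_zero]
    intro t _
    rcases lt_or_ge (t - p) 0 with h | h
    · simp [gauss_of_neg _ _ h]
    · rw [gauss_of_neg q v (show n - (t - p) < 0 by omega), mul_zero]
  lift n to ℕ using hn
  rw [gauss_natCast, ← vandermondeSum_eq h0 hq, vandermondeSum]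
  refine Finset.sum_of_injOn (fun x : ℕ × ℕ => p + (x.1 : ℤ)) ?_ ?_ ?_ ?_
  · rintro ⟨a, b⟩ hab ⟨c, d⟩ hcd h
    simp only [Finset.mem_coe,
      Finset.HasAntidiagonal.mem_antidiagonal] at hab hcd h
    ext <;> simp <;> omega
  · rintro ⟨a, b⟩ hab
    simp only [Finset.mem_coe, Finset.HasAntidiagonal.mem_antidiagonal] at hab
    simp only [Finset.coe_Icc, Set.mem_Icc]
    omega
  · intro t ht hnot
    rcases lt_or_ge (t - p) 0 with h | h
    · simp [gauss_of_neg _ _ h]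
    rcases lt_or_ge ((n : ℤ) - (t - p)) 0 with h' | h'
    · simp [gauss_of_neg _ _ h']
    exact absurd ⟨((t - p).toNat, (n - (t - p)).toNat), by
      simp only [Finset.mem_coe, Finset.HasAntidiagonal.mem_antidiagonal]; omega, by simp only; omega⟩ hnot
  · rintro ⟨a, b⟩ hab
    simp only [Finset.HasAntidiagonal.mem_antidiagonal] at hab
    subst hab
    rw [show p + ((a, b).1 : ℤ) - p = (a : ℤ) by simp, gauss_natCast,
      show ((a + b : ℕ) : ℤ) - a = (b : ℤ) by push_cast; ring, gauss_natCast]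

theorem gauss_add_eq_sum' {q : ℂ} (h0 : q ≠ 0) (hq : ∀ k : ℕ, 0 < k → q ^ k ≠ 1) (u v n : ℤ)
    {K : ℤ} (hK : n ≤ K) :
    gauss q (u + v) n = ∑ p ∈ Finset.Icc 0 K,
      q ^ (p * (u - n + p)) * gauss q u (n - p) * gauss q v p := by
  rw [gauss_add_eq_sum h0 hq u v n 0 (A := n - K) (B := n) (by omega) (by omega)]
  refine Finset.sum_nbij' (fun t => n - t) (fun t => n - t) ?_ ?_ ?_ ?_ ?_
  · intro t ht; simp only [Finset.mem_Icc] at ht ⊢; omega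
  · intro t ht; simp only [Finset.mem_Icc] at ht ⊢; omega
  · intro t _; ring
  · intro t _; ring
  · intro t _
    simp only [sub_zero, sub_sub_cancel]
    congr 3
    ring

/-- The `q`-Saalschütz sum for arbitrary integer parameters. -/
theorem gauss_saalschutz {q : ℂ} (h0 : q ≠ 0) (hq : ∀ k : ℕ, 0 < k → q ^ k ≠ 1) (c d a b : ℤ)
    {K : ℤ} (hK : a ≤ K) :
    gauss q (c + a) b * gauss q (d + b) a = ∑ t ∈ Finset.Icc 0 K,
      q ^ ((a - t) * (b - t)) * gauss q (c + d + t) t * gauss q c (b - t) * gauss q d (a - t) := by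
  rcases lt_or_ge a 0 with ha | ha
  · rw [gauss_of_neg _ _ ha, mul_zero, Finset.sum_eq_zero]
    intro t ht
    rw [Finset.mem_Icc] at ht
    rw [gauss_of_neg q d (show a - t < 0 by omega), mul_zero]
  have step : ∀ t ∈ Finset.Icc 0 K,
      q ^ ((a - t) * (b - t)) * gauss q (c + d + t) t * gauss q c (b - t) * gauss q d (a - t) =
      ∑ p ∈ Finset.Icc 0 K, (q ^ (p * (c - b + p)) * gauss q c (b - p) * gauss q (d + b) p) *
        (q ^ ((a - p - (t - p)) * (b - p - (t - p))) * gauss q (b - p) (t - p) *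
          gauss q d (a - p - (t - p))) := by
    intro t ht
    rw [Finset.mem_Icc] at ht
    -- This splitting of the top entry makes trinomial revision applicable with [c; b - t], after
    -- which t occurs only in a Vandermonde sum.
    rw [show c + d + t = (c - b + t) + (d + b) by ring,
      gauss_add_eq_sum' h0 hq (c - b + t) (d + b) t ht.2, Finset.mul_sum, Finset.sum_mul,
      Finset.sum_mul]
    refine Finset.sum_congr rfl fun p _ => ?_
    have h := gauss_mul hq c (b - t) (t - p)
    rw [show b - t + (t - p) = b - p by ring, show c - (b - t) = c - b + t by ring] at h
    rw [show c - b + t - t + p = c - b + p by ring, show a - p - (t - p) = a - t by ring,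
      show b - p - (t - p) = b - t by ring]
    linear_combination q ^ ((a - t) * (b - t)) * q ^ (p * (c - b + p)) * gauss q (d + b) p *
      gauss q d (a - t) * h
  rw [Finset.sum_congr rfl step, Finset.sum_comm, gauss_add_eq_sum' h0 hq c a b
    (K := max b K) (le_max_left _ _), Finset.sum_mul]
  symm
  -- The outer Vandermonde sum for [c + a; b] needs a range reaching b; the terms beyond K carry [a;
  -- p] with p > a ≥ 0 and vanish.
  have hsub : Finset.Icc 0 K ⊆ Finset.Icc 0 (max b K) :=
    Finset.Icc_subset_Icc le_rfl (le_max_right _ _)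
  rw [← Finset.sum_subset hsub]
  · refine Finset.sum_congr rfl fun p hp => ?_
    rw [Finset.mem_Icc] at hp
    rw [← Finset.mul_sum, ← gauss_add_eq_sum h0 hq (b - p) d (a - p) p hp.1 (by omega)]
    have h := gauss_mul hq (d + b) p (a - p)
    rw [show p + (a - p) = a by ring, gauss_symm hq ha,
      show d + b - p = b - p + d by ring] at h
    linear_combination q ^ (p * (c - b + p)) * gauss q c (b - p) * h
  · intro p _ hp
    rw [Finset.mem_Icc] at hp
    rcases lt_or_ge p 0 with h | h
    · simp [gauss_of_neg _ _ h]
    · simp [gauss_eq_zero ha (show a < p by omega)]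

/-! ### Half-integral top entries, Gaussian weights and the exchange relation -/

/-- The polynomial `q`-binomial coefficient with top entry `x / 2`, and `0` if `x` is odd. -/
def halfGauss (q : ℂ) (x n : ℤ) : ℂ := if Even x then gauss q (x / 2) n else 0

theorem halfGauss_two_mul (q : ℂ) {x : ℤ} (e n : ℤ) (h : x = 2 * e) :
    halfGauss q x n = gauss q e n := by
  subst h
  simp [halfGauss]

theorem halfGauss_of_odd (q : ℂ) {x : ℤ} (n : ℤ) (h : x % 2 = 1) : halfGauss q x n = 0 :=
  if_neg (by rw [Int.even_iff]; omega)

theorem nonneg_of_halfGauss_ne_zero {q : ℂ} {x n : ℤ} (h : halfGauss q x n ≠ 0) : 0 ≤ n := by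
  by_contra hn
  rw [halfGauss, gauss_of_neg _ _ (not_le.1 hn), ite_self] at h
  exact h rfl

theorem even_of_halfGauss_ne_zero {q : ℂ} {x n : ℤ} (h : halfGauss q x n ≠ 0) : x % 2 = 0 := by
  by_contra hn
  exact h (halfGauss_of_odd q n (by omega))

/-- Applied with x the sum of the two neighbours of an entry n, this is the discrete convexity of
chains. -/
theorem le_of_halfGauss_ne_zero {q : ℂ} {x n : ℤ} (h : halfGauss q x n ≠ 0) (hx : 0 ≤ x) :
    2 * n ≤ x := by
  by_contra hn
  have h2 := even_of_halfGauss_ne_zero h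
  rw [halfGauss_two_mul q (x / 2) n (by omega), gauss_eq_zero (by omega) (by omega)] at h
  exact h rfl

theorem qPow_add (w : ℂ) (x y : ℚ) : qPow w (x + y) = qPow w x * qPow w y := by
  simp only [qPow]
  rw [← Complex.exp_add]
  congr 1
  push_cast
  ring

theorem qPow_intCast {q w : ℂ} (hw : Complex.exp w = q) (n : ℤ) : qPow w n = q ^ n := by
  rw [qPow, ← hw, ← Complex.exp_int_mul]
  simp

/-- The Gaussian weight `q ^ (x² / 4)`. -/
def quarterSq (w : ℂ) (x : ℤ) : ℂ := qPow w ((x : ℚ) ^ 2 / 4)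

theorem quarterSq_mul_zpow {q w : ℂ} (hw : Complex.exp w = q) {x y e f : ℤ}
    (h : x ^ 2 + 4 * e = y ^ 2 + 4 * f) : quarterSq w x * q ^ e = quarterSq w y * q ^ f := by
  rw [quarterSq, quarterSq, ← qPow_intCast hw, ← qPow_intCast hw, ← qPow_add, ← qPow_add]
  congr 1
  have : (x : ℚ) ^ 2 + 4 * e = (y : ℚ) ^ 2 + 4 * f := by exact_mod_cast h
  linarith

/-- The three-fold product of `q`-binomials linking the two halves of a mixed chain. -/
def link (q : ℂ) (X M z u k v : ℤ) : ℂ :=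
  halfGauss q (X + z - u + 2 * k) k * halfGauss q (z + v - M) (u - k) *
    halfGauss q (X + M - u + v) (M - k)

/-- The exchange relation for `link`, which consists of two `q`-Saalschütz sums. -/
theorem link_exchange {q w : ℂ} (hw : Complex.exp w = q) (hq : ∀ k : ℕ, 0 < k → q ^ k ≠ 1)
    (X M z u v m : ℤ) :
    ∑ k ∈ Finset.Icc 0 M, halfGauss q (z + (m - M + 2 * k)) u * quarterSq w (u - (m - M + 2 * k)) *
        link q X M u (m - M + 2 * k) k v =
      ∑ k ∈ Finset.Icc 0 M, link q X M z u k m * quarterSq w (u - 2 * k + M - m) *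
        halfGauss q (u - 2 * k + M + v) m := by
  have h0 : q ≠ 0 := hw ▸ Complex.exp_ne_zero w
  -- The three parities do not depend on k; if one of them is odd, every term on both sides contains
  -- a vanishing factor.
  rcases Int.emod_two_eq_zero_or_one (z + m - M) with hα | hα
  swap
  · rw [Finset.sum_eq_zero, Finset.sum_eq_zero]
    · intro k _; rw [link, halfGauss_of_odd q (u - k) hα]; ring
    · intro k _; rw [halfGauss_of_odd q u (show (z + (m - M + 2 * k)) % 2 = 1 by omega)]; ring
  rcases Int.emod_two_eq_zero_or_one (X - u - m + M) with hδ | hδ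
  swap
  · rw [Finset.sum_eq_zero, Finset.sum_eq_zero]
    · intro k _; rw [link, halfGauss_of_odd q (M - k) (show (X + M - u + m) % 2 = 1 by omega)]; ring
    · intro k _
      rw [link, halfGauss_of_odd q k (show (X + u - (m - M + 2 * k) + 2 * k) % 2 = 1 by omega)]; ring
  rcases Int.emod_two_eq_zero_or_one (u + v - M) with hβ | hβ
  swap
  · rw [Finset.sum_eq_zero, Finset.sum_eq_zero]
    · intro k _; rw [halfGauss_of_odd q m (show (u - 2 * k + M + v) % 2 = 1 by omega)]; ring
    · intro k _; rw [link, halfGauss_of_odd q _ hβ]; ring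
  obtain ⟨α, hα⟩ := Int.dvd_of_emod_eq_zero hα
  obtain ⟨δ, hδ⟩ := Int.dvd_of_emod_eq_zero hδ
  obtain ⟨β, hβ⟩ := Int.dvd_of_emod_eq_zero hβ
  have hL : ∀ k ∈ Finset.Icc 0 M,
      halfGauss q (z + (m - M + 2 * k)) u * quarterSq w (u - (m - M + 2 * k)) *
        link q X M u (m - M + 2 * k) k v =
      ∑ k' ∈ Finset.Icc 0 M, (gauss q (α + δ + k') k' * gauss q α (u - k') *
        quarterSq w (u - 2 * k' + M - m)) * (q ^ ((M - k' - (M - k)) * (m - (M - k))) *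
          gauss q (β + δ + (M - k)) (M - k) * gauss q β (m - (M - k)) *
            gauss q δ (M - k' - (M - k))) := by
    intro k hk
    rw [Finset.mem_Icc] at hk
    rw [link, halfGauss_two_mul q (α + k) u (by linarith),
      halfGauss_two_mul q (δ + u) k (by linarith), halfGauss_two_mul q β _ hβ,
      halfGauss_two_mul q (β + δ + (M - k)) (M - k) (by linarith)]
    -- The first Saalschütz sum expands [α + k; u][δ + u; k] over a new index k', which will be the
    -- summation index on the other side.
    have h := gauss_saalschutz h0 hq α δ k u hk.2
    rw [show ∀ A Q B C D : ℂ, A * Q * (B * C * D) = A * B * (Q * C * D) by intros; ring, h,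
      Finset.sum_mul]
    refine Finset.sum_congr rfl fun k' _ => ?_
    have h2 : quarterSq w (u - (m - M + 2 * k)) * q ^ ((k - k') * (u - k')) =
        quarterSq w (u - 2 * k' + M - m) * q ^ ((M - k' - (M - k)) * (m - (M - k))) :=
      quarterSq_mul_zpow hw (by ring)
    rw [show m - M + 2 * k - k = m - (M - k) by ring, show M - k' - (M - k) = k - k' by ring] at *
    linear_combination gauss q (α + δ + k') k' * gauss q α (u - k') * gauss q δ (k - k') *
      gauss q β (m - (M - k)) * gauss q (β + δ + (M - k)) (M - k) * h2
  rw [Finset.sum_congr rfl hL, Finset.sum_comm]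
  refine Finset.sum_congr rfl fun k' hk' => ?_
  rw [Finset.mem_Icc] at hk'
  rw [← Finset.mul_sum, link, halfGauss_two_mul q (α + δ + k') k' (by linarith),
    halfGauss_two_mul q α _ hα, halfGauss_two_mul q (δ + m) _ (by linarith),
    halfGauss_two_mul q (β + (M - k')) m (by linarith)]
  -- For fixed k', the sum over k is a second Saalschütz sum in the variable M - k.
  have h := gauss_saalschutz h0 hq β δ (M - k') m (K := M) (by omega)
  have h2 : ∑ k ∈ Finset.Icc 0 M, q ^ ((M - k' - (M - k)) * (m - (M - k))) *
          gauss q (β + δ + (M - k)) (M - k) * gauss q β (m - (M - k)) *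
            gauss q δ (M - k' - (M - k)) = gauss q (β + (M - k')) m * gauss q (δ + m) (M - k') := by
    rw [h]
    refine Finset.sum_nbij' (fun k => M - k) (fun k => M - k) ?_ ?_ ?_ ?_ ?_
    · intro t ht; simp only [Finset.mem_Icc] at ht ⊢; omega
    · intro t ht; simp only [Finset.mem_Icc] at ht ⊢; omega
    · intro t _; ring
    · intro t _; ring
    · intro t _; rfl
  rw [h2]
  ring

/-! ### Mixed chains and moving the link through them -/

/-- Extension of a chain at its right end. -/
def stepLeft (q w : ℂ) (B : ℤ) (f : ℤ → ℤ → ℂ) (u x : ℤ) : ℂ :=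
  ∑ z ∈ Finset.Icc 0 B, f z u * halfGauss q (z + x) u * quarterSq w (u - x)

/-- Extension of a chain at its left end. -/
def stepRight (q w : ℂ) (B : ℤ) (g : ℤ → ℤ → ℂ) (a b : ℤ) : ℂ :=
  ∑ v ∈ Finset.Icc 0 B, halfGauss q (a + v) b * quarterSq w (b - v) * g b v

/-- The sum over mixed chains with left part `f` and right part `g`. -/
def mixedSum (q w : ℂ) (B X M : ℤ) (f g : ℤ → ℤ → ℂ) : ℂ :=
  ∑ z ∈ Finset.Icc 0 B, ∑ u ∈ Finset.Icc 0 B, ∑ k ∈ Finset.Icc 0 M, ∑ v ∈ Finset.Icc 0 B,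
    if u - 2 * k + M ≤ X + v then
      f z u * link q X M z u k v * quarterSq w (u - 2 * k + M - v) * g (u - 2 * k + M) v else 0

/-- The property of left parts that their last two entries increase beyond `β`. -/
def LeftConvex (β : ℤ) (f : ℤ → ℤ → ℂ) : Prop :=
  ∀ z u, 0 ≤ z → 0 ≤ u → f z u ≠ 0 → u ≤ β ∨ z ≤ u

/-- The property of right parts that a small first descent bounds the first entry. -/
def RightBounded (X b : ℤ) (g : ℤ → ℤ → ℂ) : Prop :=
  ∀ m v, 0 ≤ m → 0 ≤ v → g m v ≠ 0 → m ≤ X + v → m ≤ b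

/-- The new factor forces 2u ≤ z + x, so z ≤ u gives u ≤ x; and if u ≤ β, then either x ≤ β or x
exceeds u. -/
theorem LeftConvex.step {q w : ℂ} {B β : ℤ} {f : ℤ → ℤ → ℂ} (hf : LeftConvex β f) :
    LeftConvex β (stepLeft q w B f) := by
  intro u x hu hx h
  obtain ⟨z, hz, h⟩ := Finset.exists_ne_zero_of_sum_ne_zero h
  rw [Finset.mem_Icc] at hz
  have h1 := left_ne_zero_of_mul h
  have h2 := hf z u hz.1 hu (left_ne_zero_of_mul h1)
  have h3 := le_of_halfGauss_ne_zero (right_ne_zero_of_mul h1) (by omega)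
  omega

/-- By convexity 2m ≤ a + v, so a descent a - m of at most X makes the next descent m - v at most X
as well. Each added entry then raises the bound by X, which keeps the reindexed sums inside one box.
-/
theorem RightBounded.step {q w : ℂ} {B X b : ℤ} {g : ℤ → ℤ → ℂ} (hg : RightBounded X b g) :
    RightBounded X (b + X) (stepRight q w B g) := by
  intro a m ha hm h ham
  obtain ⟨v, hv, h⟩ := Finset.exists_ne_zero_of_sum_ne_zero h
  rw [Finset.mem_Icc] at hv
  have h1 := le_of_halfGauss_ne_zero (left_ne_zero_of_mul (left_ne_zero_of_mul h)) (by omega)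
  have h2 := hg m v hm hv.1 (right_ne_zero_of_mul h) (by omega)
  omega

/-- The inequality cutting down `mixedSum` says that the bottom entry of the third factor does not
exceed its top entry. For a nonzero link it is automatic once that top entry is nonnegative. -/
theorem link_ne_zero {q : ℂ} {X M z u k v : ℤ} (h : link q X M z u k v ≠ 0) :
    0 ≤ u - k ∧ 0 ≤ M - k ∧ (u ≤ X + M + v → u - 2 * k + M ≤ X + v) := by
  have h1 := nonneg_of_halfGauss_ne_zero (right_ne_zero_of_mul (left_ne_zero_of_mul h))
  have h2 := right_ne_zero_of_mul h
  refine ⟨h1, nonneg_of_halfGauss_ne_zero h2, fun h3 => ?_⟩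
  have := le_of_halfGauss_ne_zero h2 (by omega)
  omega

theorem sum_reverse₃ {α β γ : Type*} (r : Finset α) (s : Finset β) (t : Finset γ)
    (f : α → β → γ → ℂ) :
    ∑ a ∈ r, ∑ b ∈ s, ∑ c ∈ t, f a b c = ∑ c ∈ t, ∑ b ∈ s, ∑ a ∈ r, f a b c := by
  rw [Finset.sum_comm, Finset.sum_comm (s := t)]
  refine Finset.sum_congr rfl fun b _ => Finset.sum_comm

theorem sum_reverse₄ {α β γ δ : Type*} (r : Finset α) (s : Finset β) (t : Finset γ) (o : Finset δ)
    (f : α → β → γ → δ → ℂ) :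
    ∑ a ∈ r, ∑ b ∈ s, ∑ c ∈ t, ∑ d ∈ o, f a b c d =
      ∑ d ∈ o, ∑ c ∈ t, ∑ b ∈ s, ∑ a ∈ r, f a b c d := by
  rw [Finset.sum_congr rfl fun a _ => sum_reverse₃ s t o (f a), Finset.sum_comm]
  refine Finset.sum_congr rfl fun d _ => ?_
  rw [Finset.sum_comm]
  exact Finset.sum_congr rfl fun c _ => Finset.sum_comm

/-- The sum over mixed chains with five explicit consecutive entries. -/
def middleSum (w : ℂ) (B X M : ℤ) (f g : ℤ → ℤ → ℂ) (K : ℤ → ℤ → ℤ → ℤ → ℂ) : ℂ :=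
  ∑ z ∈ Finset.Icc 0 B, ∑ u ∈ Finset.Icc 0 B, ∑ v ∈ Finset.Icc 0 B, ∑ m ∈ Finset.Icc 0 B,
    if m ≤ X + v ∧ u ≤ X + M + m then f z u * quarterSq w (m - v) * g m v * K z u v m else 0

/-- Brings the mixed sum to a form in which the five entries z, u, v, m and k are exposed and k can
be summed first. The extra condition u ≤ X + M + m costs nothing here, by convexity of the left
part. -/
theorem mixedSum_stepLeft {q w : ℂ} {B X M β b : ℤ} {f g : ℤ → ℤ → ℂ} (hX : 0 ≤ X)
    (hβ : β ≤ X + M) (hb : b + M ≤ B) (hf : LeftConvex β f) (hg : RightBounded X b g) :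
    mixedSum q w B X M (stepLeft q w B f) g = middleSum w B X M f g fun z u v m =>
      ∑ k ∈ Finset.Icc 0 M, halfGauss q (z + (m - M + 2 * k)) u *
        quarterSq w (u - (m - M + 2 * k)) * link q X M u (m - M + 2 * k) k v := by
  have h1 : mixedSum q w B X M (stepLeft q w B f) g =
      ∑ u ∈ Finset.Icc 0 B, ∑ x ∈ Finset.Icc 0 B, ∑ k ∈ Finset.Icc 0 M, ∑ v ∈ Finset.Icc 0 B,
        ∑ z ∈ Finset.Icc 0 B, if x - 2 * k + M ≤ X + v then
          f z u * halfGauss q (z + x) u * quarterSq w (u - x) * link q X M u x k v *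
            quarterSq w (x - 2 * k + M - v) * g (x - 2 * k + M) v else 0 := by
    refine Finset.sum_congr rfl fun u _ => Finset.sum_congr rfl fun x _ =>
      Finset.sum_congr rfl fun k _ => Finset.sum_congr rfl fun v _ => ?_
    split_ifs
    · simp only [stepLeft, Finset.sum_mul]
    · simp
  rw [h1, Finset.sum_congr rfl fun u _ => sum_reverse₄ _ _ _ _ _, Finset.sum_comm]
  refine Finset.sum_congr rfl fun z hz => Finset.sum_congr rfl fun u hu =>
    Finset.sum_congr rfl fun v hv => ?_
  have h2 : ∀ m ∈ Finset.Icc 0 B, (if m ≤ X + v ∧ u ≤ X + M + m then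
      f z u * quarterSq w (m - v) * g m v * (∑ k ∈ Finset.Icc 0 M,
        halfGauss q (z + (m - M + 2 * k)) u * quarterSq w (u - (m - M + 2 * k)) *
          link q X M u (m - M + 2 * k) k v) else 0) =
      ∑ k ∈ Finset.Icc 0 M, if m ≤ X + v ∧ u ≤ X + M + m then
        f z u * quarterSq w (m - v) * g m v *
        (halfGauss q (z + (m - M + 2 * k)) u * quarterSq w (u - (m - M + 2 * k)) *
          link q X M u (m - M + 2 * k) k v) else 0 := by
    intro m _
    split_ifs
    · rw [Finset.mul_sum]
    · simp
  rw [Finset.sum_congr rfl h2, Finset.sum_comm (s := Finset.Icc 0 B)]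
  refine Finset.sum_congr rfl fun k hk => ?_
  rw [Finset.mem_Icc] at hz hu hv hk
  -- The substitution m = x - 2k + M does not preserve the range 0..B, so only nonzero terms are
  -- matched; `RightBounded` and b + M ≤ B keep them inside.
  refine Finset.sum_bij_ne_zero (fun x _ _ => x - 2 * k + M) ?_ ?_ ?_ ?_
  · intro x hx hne
    rw [Finset.mem_Icc] at hx ⊢
    obtain ⟨hc, hne⟩ := ite_ne_right_iff.1 hne
    have ha := left_ne_zero_of_mul (left_ne_zero_of_mul hne)
    obtain ⟨l1, l2, -⟩ := link_ne_zero (right_ne_zero_of_mul ha)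
    have := hg (x - 2 * k + M) v (by omega) hv.1 (right_ne_zero_of_mul hne) hc
    omega
  · intro x _ _ y _ _ h
    omega
  · intro m hm hne
    rw [Finset.mem_Icc] at hm
    obtain ⟨hc, hne⟩ := ite_ne_right_iff.1 hne
    obtain ⟨l1, l2, -⟩ := link_ne_zero (right_ne_zero_of_mul (right_ne_zero_of_mul hne))
    have := hg m v hm.1 hv.1 (right_ne_zero_of_mul (left_ne_zero_of_mul hne)) hc.1
    refine ⟨m - M + 2 * k, by rw [Finset.mem_Icc]; omega, ?_, by ring⟩
    rw [show m - M + 2 * k - 2 * k + M = m by ring, if_pos hc.1]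
    convert hne using 1
    ring
  · intro x hx hne
    rw [Finset.mem_Icc] at hx
    obtain ⟨hc, hne⟩ := ite_ne_right_iff.1 hne
    have ha := left_ne_zero_of_mul (left_ne_zero_of_mul hne)
    obtain ⟨l1, l2, -⟩ := link_ne_zero (right_ne_zero_of_mul ha)
    have hc' := left_ne_zero_of_mul (left_ne_zero_of_mul ha)
    have h3 := le_of_halfGauss_ne_zero (right_ne_zero_of_mul hc') (by omega)
    have h4 := hf z u hz.1 hu.1 (left_ne_zero_of_mul hc')
    rw [if_pos hc, if_pos ⟨hc, by omega⟩, show x - 2 * k + M - M + 2 * k = x by ring]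
    ring

/-- Here u ≤ X + M + m is equivalent to the inequality of `mixedSum` by `link_ne_zero` and k ≤ M,
while m ≤ X + v follows from it by convexity at m. -/
theorem mixedSum_stepRight {q w : ℂ} {B X M : ℤ} {f g : ℤ → ℤ → ℂ} :
    mixedSum q w B X M f (stepRight q w B g) = middleSum w B X M f g fun z u v m =>
      ∑ k ∈ Finset.Icc 0 M, link q X M z u k m * quarterSq w (u - 2 * k + M - m) *
        halfGauss q (u - 2 * k + M + v) m := by
  refine Finset.sum_congr rfl fun z hz => Finset.sum_congr rfl fun u hu => ?_
  have h1 : ∀ k ∈ Finset.Icc 0 M, ∀ m ∈ Finset.Icc 0 B, (if u - 2 * k + M ≤ X + m then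
      f z u * link q X M z u k m * quarterSq w (u - 2 * k + M - m) *
        stepRight q w B g (u - 2 * k + M) m else 0) = ∑ v ∈ Finset.Icc 0 B,
      if m ≤ X + v ∧ u ≤ X + M + m then f z u * quarterSq w (m - v) * g m v *
        (link q X M z u k m * quarterSq w (u - 2 * k + M - m) *
        halfGauss q (u - 2 * k + M + v) m) else 0 := by
    intro k hk m hm
    have h2 : (if u - 2 * k + M ≤ X + m then
      f z u * link q X M z u k m * quarterSq w (u - 2 * k + M - m) *
        stepRight q w B g (u - 2 * k + M) m else 0) = ∑ v ∈ Finset.Icc 0 B,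
        if u - 2 * k + M ≤ X + m then f z u * quarterSq w (m - v) * g m v *
        (link q X M z u k m * quarterSq w (u - 2 * k + M - m) *
        halfGauss q (u - 2 * k + M + v) m) else 0 := by
      split_ifs
      · rw [stepRight, Finset.mul_sum]
        exact Finset.sum_congr rfl fun v _ => by ring
      · simp
    rw [h2]
    refine Finset.sum_congr rfl fun v hv => ?_
    rw [Finset.mem_Icc] at hk hm hv hu
    by_cases hne : f z u * quarterSq w (m - v) * g m v *
        (link q X M z u k m * quarterSq w (u - 2 * k + M - m) *
        halfGauss q (u - 2 * k + M + v) m) = 0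
    · simp only [hne, ite_self]
    · have h3 := right_ne_zero_of_mul hne
      obtain ⟨l1, l2, l3⟩ := link_ne_zero (left_ne_zero_of_mul (left_ne_zero_of_mul h3))
      have h4 := le_of_halfGauss_ne_zero (right_ne_zero_of_mul h3) (by omega)
      refine if_congr ⟨fun h => ⟨by omega, by omega⟩, fun h => l3 h.2⟩ rfl rfl
  rw [Finset.sum_congr rfl fun k hk => Finset.sum_congr rfl (h1 k hk), sum_reverse₃]
  refine Finset.sum_congr rfl fun v _ => Finset.sum_congr rfl fun m _ => ?_
  split_ifs
  · rw [Finset.mul_sum]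
  · simp

theorem mixedSum_step {q w : ℂ} (hw : Complex.exp w = q) (hq : ∀ k : ℕ, 0 < k → q ^ k ≠ 1)
    {B X M β b : ℤ} {f g : ℤ → ℤ → ℂ} (hX : 0 ≤ X)
    (hβ : β ≤ X + M) (hb : b + M ≤ B) (hf : LeftConvex β f) (hg : RightBounded X b g) :
    mixedSum q w B X M (stepLeft q w B f) g = mixedSum q w B X M f (stepRight q w B g) := by
  rw [mixedSum_stepLeft hX hβ hb hf hg, mixedSum_stepRight]
  congr 1
  ext z u v m
  exact link_exchange hw hq X M z u v m

theorem LeftConvex.iterate {q w : ℂ} {B β : ℤ} {f : ℤ → ℤ → ℂ} (hf : LeftConvex β f) (n : ℕ) :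
    LeftConvex β ((stepLeft q w B)^[n] f) := by
  induction n with
  | zero => exact hf
  | succ n ih => rw [Function.iterate_succ_apply']; exact ih.step

theorem mixedSum_iterate {q w : ℂ} (hw : Complex.exp w = q) (hq : ∀ k : ℕ, 0 < k → q ^ k ≠ 1)
    {B X M β : ℤ} {f : ℤ → ℤ → ℂ} (hX : 0 ≤ X) (hβ : β ≤ X + M) (hf : LeftConvex β f) (n : ℕ)
    {b : ℤ} {g : ℤ → ℤ → ℂ} (hb : b + n * X + M ≤ B) (hg : RightBounded X b g) :
    mixedSum q w B X M ((stepLeft q w B)^[n] f) g =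
      mixedSum q w B X M f ((stepRight q w B)^[n] g) := by
  induction n generalizing b g with
  | zero => rfl
  | succ n ih =>
    have h : 0 ≤ (n : ℤ) * X := by positivity
    push_cast at hb
    rw [Function.iterate_succ_apply', Function.iterate_succ_apply,
      mixedSum_step hw hq hX hβ (b := b) (by linarith) (hf.iterate n) hg]
    exact ih (b := b + X) (by linarith) hg.step

/-! ### The two extreme positions of the link -/

/-- The right part consisting of the single entry `0`. -/
def rightEnd (_ v : ℤ) : ℂ := if v = 0 then 1 else 0

/-- The left part consisting of the entries `a` and `b`. -/
def leftEnd (a b z u : ℤ) : ℂ := if z = a ∧ u = b then 1 else 0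

theorem rightBounded_rightEnd (X : ℤ) : RightBounded X X rightEnd := by
  intro m v _ _ h hm
  have : v = 0 := by by_contra h'; exact h (if_neg h')
  omega

theorem leftConvex_leftEnd (a b : ℤ) : LeftConvex b (leftEnd a b) := by
  intro z u _ _ h
  have : z = a ∧ u = b := by by_contra h'; exact h (if_neg h')
  omega

/-- Chains ending in `M`, weighted with the last `q`-binomial. -/
def closedSum (q w : ℂ) (B X M : ℤ) (f : ℤ → ℤ → ℂ) : ℂ :=
  ∑ z ∈ Finset.Icc 0 B, ∑ u ∈ Finset.Icc 0 B,
    f z u * (halfGauss q (z + M) u * quarterSq w (u - M) * halfGauss q (X + M + u) M)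

theorem halfGauss_saalschutz {q w : ℂ} (hw : Complex.exp w = q)
    (hq : ∀ k : ℕ, 0 < k → q ^ k ≠ 1) (X M z u : ℤ) :
    halfGauss q (z + M) u * quarterSq w (u - M) * halfGauss q (X + M + u) M =
      ∑ k ∈ Finset.Icc 0 M, link q X M z u k 0 * quarterSq w (u - 2 * k + M) := by
  have h0 : q ≠ 0 := hw ▸ Complex.exp_ne_zero w
  rcases Int.emod_two_eq_zero_or_one (z - M) with hα | hα
  swap
  · rw [Finset.sum_eq_zero, halfGauss_of_odd q u (show (z + M) % 2 = 1 by omega)]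
    · ring
    · intro k _; rw [link, halfGauss_of_odd q (u - k) (by omega)]; ring
  rcases Int.emod_two_eq_zero_or_one (X + M - u) with hδ | hδ
  swap
  · rw [Finset.sum_eq_zero, halfGauss_of_odd q M (show (X + M + u) % 2 = 1 by omega)]
    · ring
    · intro k _; rw [link, halfGauss_of_odd q (M - k) (by omega)]; ring
  obtain ⟨α, hα⟩ := Int.dvd_of_emod_eq_zero hα
  obtain ⟨δ, hδ⟩ := Int.dvd_of_emod_eq_zero hδ
  rw [halfGauss_two_mul q (α + M) u (by linarith), halfGauss_two_mul q (δ + u) M (by linarith),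
    mul_right_comm, gauss_saalschutz h0 hq α δ M u le_rfl, Finset.sum_mul]
  refine Finset.sum_congr rfl fun k _ => ?_
  have h2 : quarterSq w (u - M) * q ^ ((M - k) * (u - k)) = quarterSq w (u - 2 * k + M) * q ^ (0 : ℤ) :=
    quarterSq_mul_zpow hw (by ring)
  rw [zpow_zero, mul_one] at h2
  rw [link, halfGauss_two_mul q (α + δ + k) k (by linarith), halfGauss_two_mul q α _ (by linarith),
    halfGauss_two_mul q δ _ (by linarith)]
  linear_combination gauss q (α + δ + k) k * gauss q α (u - k) * gauss q δ (M - k) * h2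

theorem closedSum_eq_mixedSum {q w : ℂ} (hw : Complex.exp w = q)
    (hq : ∀ k : ℕ, 0 < k → q ^ k ≠ 1) {B X M β : ℤ} {f : ℤ → ℤ → ℂ} (hX : 0 ≤ X) (hM : 0 ≤ M)
    (hB : 0 ≤ B) (hβ : β ≤ X + M) (hf : LeftConvex β f) :
    closedSum q w B X M f = mixedSum q w B X M f rightEnd := by
  refine Finset.sum_congr rfl fun z hz => Finset.sum_congr rfl fun u hu => ?_
  rw [Finset.mem_Icc] at hz hu
  have hR : ∀ k ∈ Finset.Icc 0 M, ∑ v ∈ Finset.Icc 0 B, (if u - 2 * k + M ≤ X + v then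
      f z u * link q X M z u k v * quarterSq w (u - 2 * k + M - v) *
        rightEnd (u - 2 * k + M) v else 0) =
      if u ≤ X + M then f z u * (link q X M z u k 0 * quarterSq w (u - 2 * k + M)) else 0 := by
    intro k hk
    rw [Finset.mem_Icc] at hk
    rw [Finset.sum_eq_single_of_mem 0 (by simpa using hB)]
    · simp only [rightEnd, if_true, mul_one, sub_zero, add_zero]
      by_cases hne : link q X M z u k 0 = 0
      · simp [hne]
      · obtain ⟨-, l2, l3⟩ := link_ne_zero hne
        rw [mul_assoc]
        exact if_congr ⟨fun h => by
          have := right_ne_zero_of_mul hne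
          by_contra h'
          omega, fun h => by omega⟩ rfl rfl
    · intro v _ hv
      simp [rightEnd, hv]
  rw [Finset.sum_congr rfl hR]
  by_cases hu' : u ≤ X + M
  · simp only [if_pos hu']
    rw [← Finset.mul_sum, halfGauss_saalschutz hw hq]
  · simp only [if_neg hu', Finset.sum_const_zero]
    -- A nonzero term with u > X + M ≥ β would have z ≤ u, and 2u ≤ z + M would give u ≤ M, against
    -- X ≥ 0.
    by_contra hne
    have h1 := le_of_halfGauss_ne_zero
      (left_ne_zero_of_mul (left_ne_zero_of_mul (right_ne_zero_of_mul hne))) (by omega)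
    have h2 := hf z u hz.1 hu.1 (left_ne_zero_of_mul hne)
    omega

/-- With z = Y + M, u = M + l and k = M - i, the right part starts at 2i + l. Since X - l + v ≥ 0,
the inequality in `mixedSum` holds for every nonzero term and disappears. -/
theorem mixedSum_leftEnd {q w : ℂ} {B X M Y l : ℤ} (g : ℤ → ℤ → ℂ) (hl : l ≤ X) (hY : 0 ≤ Y + M)
    (hYB : Y + M ≤ B) (hMl : 0 ≤ M + l) (hMB : M + l ≤ B) :
    mixedSum q w B X M (leftEnd (Y + M) (M + l)) g =
      ∑ i ∈ Finset.Icc 0 M, halfGauss q (Y + (X - l) + 2 * (M - i)) (M - i) *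
        ∑ v ∈ Finset.Icc 0 B, halfGauss q (Y + v) (i + l) * halfGauss q (X - l + v) i *
          (quarterSq w (2 * i + l - v) * g (2 * i + l) v) := by
  rw [mixedSum, Finset.sum_eq_single_of_mem (Y + M) (by simp [hY, hYB]),
    Finset.sum_eq_single_of_mem (M + l) (by simp [hMl, hMB])]
  · refine Finset.sum_nbij' (fun k => M - k) (fun k => M - k) ?_ ?_ ?_ ?_ ?_
    · intro t ht; simp only [Finset.mem_Icc] at ht ⊢; omega
    · intro t ht; simp only [Finset.mem_Icc] at ht ⊢; omega
    · intro t _; ring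
    · intro t _; ring
    · intro k _
      rw [Finset.mul_sum]
      refine Finset.sum_congr rfl fun v hv => ?_
      rw [Finset.mem_Icc] at hv
      rw [show M + l - 2 * k + M = 2 * (M - k) + l by ring, leftEnd, if_pos (And.intro rfl rfl), one_mul, link,
        show X + (Y + M) - (M + l) + 2 * k = Y + (X - l) + 2 * (M - (M - k)) by ring,
        show Y + M + v - M = Y + v by ring, show M + l - k = M - k + l by ring,
        show X + M - (M + l) + v = X - l + v by ring, sub_sub_cancel]
      by_cases hne : halfGauss q (X - l + v) (M - k) = 0
      · simp [hne]
      · have := le_of_halfGauss_ne_zero hne (by omega)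
        rw [if_pos (by omega)]
        ring
  · intro u _ hu
    simp [leftEnd, hu]
  · intro z _ hz
    simp [leftEnd, hz]

/-- A convex chain of nonnegative entries ending in 0 is weakly decreasing. -/
theorem stepRight_iterate_rightEnd_le {q w : ℂ} {B : ℤ} (n : ℕ) :
    ∀ a b, 0 ≤ a → 0 ≤ b → (stepRight q w B)^[n] rightEnd a b ≠ 0 → b ≤ a := by
  induction n with
  | zero =>
    intro a b ha _ h
    have : b = 0 := by by_contra h'; exact h (if_neg h')
    omega
  | succ n ih =>
    intro a b ha hb h
    rw [Function.iterate_succ_apply'] at h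
    obtain ⟨v, hv, h⟩ := Finset.exists_ne_zero_of_sum_ne_zero h
    rw [Finset.mem_Icc] at hv
    have h1 := le_of_halfGauss_ne_zero (left_ne_zero_of_mul (left_ne_zero_of_mul h)) (by omega)
    have h2 := ih b v hb hv.1 (right_ne_zero_of_mul h)
    omega

/-- The summation formula in terms of iterated sums over chains. -/
theorem chain_identity {q w : ℂ} (hw : Complex.exp w = q)
    (hq : ∀ k : ℕ, 0 < k → q ^ k ≠ 1) {B X M Y l : ℤ} (n : ℕ) (hl : l ≤ X) (hY : 0 ≤ Y)
    (hM : 0 ≤ M) (hMl : 0 ≤ M + l) (hYB : Y + M ≤ B) (hMB : M + l ≤ B)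
    (hXB : X + n * X + M ≤ B) :
    ∑ i ∈ Finset.Icc 0 M, halfGauss q (Y + (X - l) + 2 * (M - i)) (M - i) *
        ∑ v ∈ Finset.Icc 0 B, halfGauss q (Y + v) (i + l) * halfGauss q (X - l + v) i *
          (quarterSq w (2 * i + l - v) * (stepRight q w B)^[n] rightEnd (2 * i + l) v) =
      closedSum q w B X M ((stepLeft q w B)^[n] (leftEnd (Y + M) (M + l))) := by
  have hconv := (leftConvex_leftEnd (Y + M) (M + l)).iterate (q := q) (w := w) (B := B) n
  rcases lt_or_ge X 0 with hX | hX
  -- The link argument needs X ≥ 0. For X < 0, which forces l < 0, convexity makes every term on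
  -- both sides vanish.
  · rw [closedSum, Finset.sum_eq_zero, Finset.sum_eq_zero]
    · intro z hz
      refine Finset.sum_eq_zero fun u hu => ?_
      rw [Finset.mem_Icc] at hz hu
      by_contra hne
      have h0 := right_ne_zero_of_mul hne
      have h1 := le_of_halfGauss_ne_zero (left_ne_zero_of_mul (left_ne_zero_of_mul h0)) (by omega)
      have h2 := hconv z u hz.1 hu.1 (left_ne_zero_of_mul hne)
      have h3 := right_ne_zero_of_mul h0
      have h4 := le_of_halfGauss_ne_zero h3 (by omega)
      omega
    · intro i hi
      rw [Finset.mem_Icc] at hi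
      rw [Finset.sum_eq_zero, mul_zero]
      intro v hv
      rw [Finset.mem_Icc] at hv
      by_contra hne
      have h0 := left_ne_zero_of_mul hne
      have h1 := nonneg_of_halfGauss_ne_zero (left_ne_zero_of_mul h0)
      have h2 := le_of_halfGauss_ne_zero (right_ne_zero_of_mul h0) (by omega)
      have h3 := stepRight_iterate_rightEnd_le n (2 * i + l) v (by omega) hv.1
        (right_ne_zero_of_mul (right_ne_zero_of_mul hne))
      omega
  · rw [closedSum_eq_mixedSum hw hq hX hM (by omega) (β := M + l) (by omega) hconv,
      mixedSum_iterate hw hq hX (β := M + l) (by omega) (leftConvex_leftEnd _ _) n hXB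
        (rightBounded_rightEnd X),
      mixedSum_leftEnd _ hl (by omega) hYB hMl hMB]

/-! ### Comparison with the truncated q-binomials -/

theorem qBinom_of_neg (q : ℂ) (a : ℚ) {b : ℚ} (h : b < 0) : qBinom q a b = 0 :=
  if_neg fun h' => absurd h'.2.2.1 (not_le.2 h)

theorem qBinom_intCast {q : ℂ} (hq : ∀ k : ℕ, 0 < k → q ^ k ≠ 1) {e : ℤ} (he : 0 ≤ e) (b : ℤ) :
    qBinom q e b = gauss q e b := by
  by_cases h : 0 ≤ b ∧ b ≤ e
  · obtain ⟨k, rfl⟩ := Int.le.dest h.2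
    have hb := h.1
    lift b to ℕ using hb
    rw [qBinom, if_pos ⟨Rat.den_intCast _, Rat.den_intCast _, by exact_mod_cast h.1,
      by exact_mod_cast h.2⟩, ← Int.cast_sub, Int.floor_intCast, Int.floor_intCast,
      Int.floor_intCast, gauss_natCast, add_comm (b : ℤ), gaussNat_add hq, add_sub_cancel_right,
      ← Nat.cast_add, Int.toNat_natCast, Int.toNat_natCast, Int.toNat_natCast, mul_comm]
  · rw [qBinom, if_neg]
    · rcases lt_or_ge b 0 with hb | hb
      · rw [gauss_of_neg _ _ hb]
      · rw [gauss_eq_zero he (by omega)]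
    · rintro ⟨-, -, h1, h2⟩
      exact h ⟨by exact_mod_cast h1, by exact_mod_cast h2⟩

/-- The truncated and the polynomial versions agree as long as the top entry is nonnegative; an odd
x gives 0 on both sides, since x/2 is not an integer. -/
theorem qBinom_eq_halfGauss {q : ℂ} (hq : ∀ k : ℕ, 0 < k → q ^ k ≠ 1) {a b' : ℚ} {x b : ℤ}
    (ha : a = x / 2) (hb : b' = b) (hx : 0 ≤ x) : qBinom q a b' = halfGauss q x b := by
  subst hb
  rcases Int.emod_two_eq_zero_or_one x with h | h
  · obtain ⟨e, rfl⟩ := Int.dvd_of_emod_eq_zero h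
    rw [halfGauss_two_mul q e b rfl, show a = (e : ℚ) by rw [ha]; push_cast; ring,
      qBinom_intCast hq (by omega)]
  · rw [halfGauss_of_odd q b h, qBinom, if_neg]
    rintro ⟨h1, -⟩
    rw [Rat.den_eq_one_iff, ha, eq_div_iff two_ne_zero] at h1
    have h2 : ((x : ℚ) / 2).num * 2 = x := by exact_mod_cast h1
    omega

theorem of_qBinom_ne_zero {q : ℂ} {a b : ℚ} (h : qBinom q a b ≠ 0) :
    a.den = 1 ∧ b.den = 1 ∧ 0 ≤ b ∧ b ≤ a := by
  by_contra h'
  exact h (if_neg h')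

/-! ### Vectors with boundary values, the Cartan matrix as a second difference -/

section Entry

variable {R : Type*}

/-- The component `v_j` of `v`, extended by boundary values on both sides. -/
def entry {n : ℕ} (a b : R) (v : Fin n → R) (j : ℕ) : R :=
  if j = 0 then a else if h : j - 1 < n then v ⟨j - 1, h⟩ else b

variable {n : ℕ} (a b : R) (v : Fin n → R)

@[simp] theorem entry_zero : entry a b v 0 = a := if_pos rfl

theorem entry_succ {k : ℕ} (hk : k < n) : entry a b v (k + 1) = v ⟨k, hk⟩ := by
  simp [entry, hk]

@[simp] theorem entry_fin_succ (k : Fin n) : entry a b v ((k : ℕ) + 1) = v k :=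
  entry_succ a b v k.2

theorem entry_of_lt {j : ℕ} (hj : n < j) : entry a b v j = b := by
  rw [entry, if_neg (by omega), dif_neg (by omega)]

theorem entry_snoc {c : R} (v : Fin n → R) {j : ℕ} (hj : j ≤ n + 1) :
    entry a b (Fin.snoc v c : Fin (n + 1) → R) j = entry a c v j := by
  rcases j with _ | j
  · simp
  rw [entry_succ _ _ _ (by omega : j < n + 1)]
  rcases (by omega : j < n ∨ j = n) with h | rfl
  · rw [entry_succ _ _ _ h]
    exact Fin.snoc_castSucc (α := fun _ => R) c v ⟨j, h⟩
  · rw [entry_of_lt _ _ _ (by omega)]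
    exact Fin.snoc_last (α := fun _ => R) c v

theorem entry_cons {c : R} (v : Fin n → R) (j : ℕ) :
    entry a b (Fin.cons c v : Fin (n + 1) → R) (j + 1) = entry c b v j := by
  rcases j with _ | j
  · rw [entry_succ _ _ _ (by omega : 0 < n + 1)]; rfl
  by_cases h : j < n
  · rw [entry_succ _ _ _ h, entry_succ _ _ _ (by omega : j + 1 < n + 1)]; rfl
  · rw [entry_of_lt _ _ _ (by omega), entry_of_lt _ _ _ (by omega)]

theorem sum_ite_succ_eq_entry [AddCommMonoid R] (v : Fin n → R) (i : ℕ) :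
    ∑ j : Fin n, (if (j : ℕ) + 1 = i then v j else 0) = entry 0 0 v i := by
  rcases i with _ | i
  · simp
  by_cases h : i < n
  · rw [entry_succ _ _ _ h, Finset.sum_eq_single ⟨i, h⟩]
    · simp
    · intro j _ hj
      rw [if_neg]
      intro h'
      exact hj (Fin.ext (by simpa using h'))
    · simp
  · rw [entry_of_lt _ _ _ (by omega), Finset.sum_eq_zero]
    intro j _
    rw [if_neg (by omega)]

theorem cartan_mulVec [CommRing R] (v : Fin n → R) (k : Fin n) :
    ((CartanMatrix.A n).map (fun z : ℤ => (z : R)) *ᵥ v) k =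
      2 * v k - entry 0 0 v k - entry 0 0 v (k + 2) := by
  have h : ∀ j : Fin n, ((CartanMatrix.A n k j : ℤ) : R) * v j =
      2 * (if (j : ℕ) + 1 = k + 1 then v j else 0) - (if (j : ℕ) + 1 = k then v j else 0) -
        (if (j : ℕ) + 1 = k + 2 then v j else 0) := by
    intro j
    simp only [CartanMatrix.A, Matrix.of_apply, Fin.ext_iff]
    split_ifs <;> first | omega | simp
  simp only [Matrix.mulVec, dotProduct, Matrix.map_apply]
  rw [Finset.sum_congr rfl fun j _ => h j, Finset.sum_sub_distrib, Finset.sum_sub_distrib,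
    ← Finset.mul_sum]
  simp only [sum_ite_succ_eq_entry, entry_fin_succ]

/-- Summation by parts. It serves both the invertibility of C and the evaluation of n C⁻¹ n, where x
vanishes at both ends. -/
theorem sum_mul_second_difference [CommRing R] (x : ℕ → R) (n : ℕ) :
    ∑ k ∈ Finset.range n, x (k + 1) * (2 * x (k + 1) - x k - x (k + 2)) =
      ∑ j ∈ Finset.range (n + 1), (x (j + 1) - x j) ^ 2 + x 0 * (x 1 - x 0) -
        x (n + 1) * (x (n + 1) - x n) := by
  induction n with
  | zero => simp; ring
  | succ n ih =>
    rw [Finset.sum_range_succ, ih, Finset.sum_range_succ _ (n + 1)]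
    ring

/-- A convex sequence that rises above B keeps rising up to its right end, where it is at most B. -/
theorem le_of_convex {e : ℕ → ℤ} {n : ℕ} {B : ℤ} (h0 : e 0 ≤ B) (hn : e (n + 1) ≤ B)
    (h : ∀ k < n, 2 * e (k + 1) ≤ e k + e (k + 2)) : ∀ j ≤ n + 1, e j ≤ B := by
  have key : ∀ i j, j + i = n → ¬ (B < e (j + 1) ∧ e j < e (j + 1)) := by
    intro i
    induction i with
    | zero => rintro j rfl h'; simp at hn; omega
    | succ i ih =>
      intro j hj h'
      have h1 := h j (by omega)
      exact ih (j + 1) (by omega) ⟨by rw [show j + 1 + 1 = j + 2 from rfl]; omega,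
        by rw [show j + 1 + 1 = j + 2 from rfl]; omega⟩
  intro j
  induction j with
  | zero => intro _; exact h0
  | succ j ih =>
    intro hj
    have h1 := key (n - j) j (by omega)
    have h2 := ih (by omega)
    omega

end Entry

/-- If Cx = 0, then the sum of squared differences of x, extended by 0, vanishes, so x is constant
and hence 0. -/
theorem isUnit_cartan (n : ℕ) : IsUnit ((CartanMatrix.A n).map (fun z : ℤ => (z : ℚ))) := by
  rw [← Matrix.mulVec_injective_iff_isUnit]
  refine (injective_iff_map_eq_zero
    (Matrix.mulVecLin ((CartanMatrix.A n).map (fun z : ℤ => (z : ℚ))))).2 fun x hx => ?_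
  have h1 := sum_mul_second_difference (entry 0 0 x) n
  rw [Finset.sum_eq_zero, entry_zero, entry_of_lt _ _ _ n.lt_succ_self] at h1
  · have h2 : ∑ j ∈ Finset.range (n + 1), (entry 0 0 x (j + 1) - entry 0 0 x j) ^ 2 = 0 := by
      linarith
    rw [Finset.sum_eq_zero_iff_of_nonneg fun _ _ => sq_nonneg _] at h2
    have h3 : ∀ j ≤ n, entry 0 0 x j = 0 := by
      intro j
      induction j with
      | zero => simp
      | succ j ih =>
        intro hj
        have := h2 j (by rw [Finset.mem_range]; omega)
        rw [sq_eq_zero_iff, ih (by omega), sub_zero] at this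
        exact this
    funext k
    rw [← entry_fin_succ 0 0 x k, h3 _ (by omega), Pi.zero_apply]
  · intro k hk
    rw [Finset.mem_range] at hk
    have := congrFun hx ⟨k, hk⟩
    rw [Matrix.mulVecLin_apply, cartan_mulVec] at this
    rw [entry_succ _ _ _ hk]
    simp only [Pi.zero_apply] at this
    rw [this, mul_zero]

/-! ### The linear system and the quadratic form along a chain -/

/-- The linear system for the pairs `(m, n)` in terms of the extended vector `m`. -/
def ChainSystem {n : ℕ} (β₀ β₁ : ℤ) (p : (Fin n → ℤ) × (Fin n → ℤ)) : Prop :=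
  ∀ k : Fin n, 2 * (p.1 k + p.2 k) = entry β₀ β₁ p.1 k + entry β₀ β₁ p.1 (k + 2)

theorem incidence_mulVec {n : ℕ} (β₀ β₁ : ℤ) (m : Fin n → ℤ) (k : Fin n) :
    (incidence (n + 1) *ᵥ m + (β₀ • unitVec (n + 1) 1 + β₁ • unitVec (n + 1) (n + 1 - 1))) k =
      entry β₀ β₁ m k + entry β₀ β₁ m (k + 2) := by
  have h1 := cartan_mulVec m k
  have h2 : (CartanMatrix.A n).map (fun z : ℤ => (Int.cast z : ℤ)) = CartanMatrix.A n := by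
    ext; simp
  rw [h2] at h1
  have h3 : (incidence (n + 1) *ᵥ m) k = entry 0 0 m k + entry 0 0 m (k + 2) := by
    rw [incidence, Matrix.sub_mulVec, Matrix.smul_mulVec, Matrix.one_mulVec]
    change 2 • m k - (CartanMatrix.A n *ᵥ m) k = _
    rw [h1, nsmul_eq_mul]
    push_cast
    ring
  have h4 : ∀ i ≤ n + 1, entry β₀ β₁ m i =
      entry 0 0 m i + (if i = 0 then β₀ else 0) + (if i = n + 1 then β₁ else 0) := by
    intro i hi
    rcases i with _ | i
    · simp
    rcases (by omega : i < n ∨ i = n) with h | rfl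
    · rw [entry_succ _ _ _ h, entry_succ _ _ _ h, if_neg (by omega), if_neg (by omega)]; ring
    · rw [entry_of_lt _ _ _ (by omega), entry_of_lt _ _ _ (by omega)]; simp
  have hk := k.2
  have h5 : (β₀ • unitVec (n + 1) 1 + β₁ • unitVec (n + 1) (n + 1 - 1)) k =
      (if (k : ℕ) + 1 = 1 then β₀ else 0) + (if (k : ℕ) + 1 = n then β₁ else 0) := by
    change β₀ * (if (k : ℕ) + 1 = 1 then 1 else 0) + β₁ * (if (k : ℕ) + 1 = n then 1 else 0) = _
    simp only [mul_ite, mul_one, mul_zero]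
  rw [Pi.add_apply, h3, h4 k (by omega), h4 (k + 2) (by omega), h5]
  split_ifs <;> first | contradiction | omega

section Solution

variable {n : ℕ} {β₀ β₁ : ℤ} {p : (Fin n → ℤ) × (Fin n → ℤ)}

/-- The linear interpolation between the boundary values. -/
def interpolation (n : ℕ) (β₀ β₁ : ℤ) (j : ℕ) : ℚ :=
  β₀ + j * ((β₁ - β₀ : ℚ) / (n + 1))

/-- The image of the second vector of a solution under the inverse Cartan matrix. -/
def potential (β₀ β₁ : ℤ) (m : Fin n → ℤ) (k : Fin n) : ℚ :=
  (interpolation n β₀ β₁ (k + 1) - m k) / 2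

theorem entry_potential (m : Fin n → ℤ) {j : ℕ} (hj : j ≤ n + 1) :
    entry 0 0 (potential β₀ β₁ m) j = (interpolation n β₀ β₁ j - entry β₀ β₁ m j) / 2 := by
  rcases j with _ | j
  · simp [interpolation]
  rcases (by omega : j < n ∨ j = n) with h | rfl
  · rw [entry_succ _ _ _ h, entry_succ _ _ _ h, potential]
  · rw [entry_of_lt _ _ _ (by omega), entry_of_lt _ _ _ (by omega), interpolation]
    have : (j : ℚ) + 1 ≠ 0 := by positivity
    push_cast
    field_simp
    ring

theorem cartan_mulVec_potential (hp : ChainSystem β₀ β₁ p) (k : Fin n) :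
    2 * potential β₀ β₁ p.1 k - entry 0 0 (potential β₀ β₁ p.1) k -
      entry 0 0 (potential β₀ β₁ p.1) (k + 2) = p.2 k := by
  have hk := k.2
  rw [entry_potential _ (by omega), entry_potential _ (by omega), potential]
  have h : (2 * (p.1 k + p.2 k) : ℚ) = entry β₀ β₁ p.1 k + entry β₀ β₁ p.1 (k + 2) := by
    exact_mod_cast hp k
  simp only [interpolation]
  push_cast
  linarith

/-- The system reads Cm + 2n = b, and C⁻¹b is the linear interpolation of the end values because its
second differences vanish. -/
theorem cartanInv_mulVec (hp : ChainSystem β₀ β₁ p) :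
    (cartanInv (n + 1) *ᵥ fun k => (p.2 k : ℚ)) = potential β₀ β₁ p.1 := by
  have h : (fun k => (p.2 k : ℚ)) =
      (CartanMatrix.A n).map (fun z : ℤ => (z : ℚ)) *ᵥ potential β₀ β₁ p.1 := by
    funext k
    rw [cartan_mulVec, cartan_mulVec_potential hp]
  change ((CartanMatrix.A n).map (fun z : ℤ => (z : ℚ)))⁻¹ *ᵥ (fun k : Fin n => (p.2 k : ℚ)) = _
  rw [h, Matrix.mulVec_mulVec, Matrix.nonsing_inv_mul _ ((Matrix.isUnit_iff_isUnit_det _).1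
    (isUnit_cartan n)), Matrix.one_mulVec]

theorem cartanInvFirst_eq (hp : ChainSystem β₀ β₁ p) :
    cartanInvFirst (n + 1) p.2 = (interpolation n β₀ β₁ 1 - entry β₀ β₁ p.1 1) / 2 := by
  rw [cartanInvFirst, cartanInv_mulVec hp, ← entry_potential p.1 (by omega),
    ← sum_ite_succ_eq_entry, dotProduct]
  refine Finset.sum_congr rfl fun k _ => ?_
  simp only [unitVec]
  split_ifs <;> simp

/-- The form is the sum of squared differences of C⁻¹n = (interpolation - m)/2. The cross term
telescopes, leaving the energy of m minus that of the interpolation. -/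
theorem cartanInvForm_eq (hp : ChainSystem β₀ β₁ p) :
    cartanInvForm (n + 1) p.2 =
      ∑ j ∈ Finset.range (n + 1), ((entry β₀ β₁ p.1 j - entry β₀ β₁ p.1 (j + 1) : ℤ) : ℚ) ^ 2 / 4 -
        (β₁ - β₀ : ℚ) ^ 2 / (4 * (n + 1)) := by
  have hn : (n : ℚ) + 1 ≠ 0 := by positivity
  rw [cartanInvForm, cartanInv_mulVec hp, dotProduct]
  have h1 : ∑ k : Fin n, (p.2 k : ℚ) * potential β₀ β₁ p.1 k = ∑ k ∈ Finset.range n,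
      entry 0 0 (potential β₀ β₁ p.1) (k + 1) * (2 * entry 0 0 (potential β₀ β₁ p.1) (k + 1) -
        entry 0 0 (potential β₀ β₁ p.1) k - entry 0 0 (potential β₀ β₁ p.1) (k + 2)) := by
    rw [Finset.sum_range]
    refine Finset.sum_congr rfl fun k _ => ?_
    rw [entry_fin_succ, cartan_mulVec_potential hp, mul_comm]
  have h2 : ∀ j ∈ Finset.range (n + 1), (entry 0 0 (potential β₀ β₁ p.1) (j + 1) -
      entry 0 0 (potential β₀ β₁ p.1) j) ^ 2 =
      ((entry β₀ β₁ p.1 j - entry β₀ β₁ p.1 (j + 1) : ℤ) : ℚ) ^ 2 / 4 +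
      (((β₁ - β₀ : ℚ) / (n + 1)) ^ 2 / 4 - ((β₁ - β₀ : ℚ) / (n + 1)) / 2 *
        (((entry β₀ β₁ p.1 (j + 1) : ℤ) : ℚ) - ((entry β₀ β₁ p.1 j : ℤ) : ℚ))) := by
    intro j hj
    rw [Finset.mem_range] at hj
    rw [entry_potential _ (by omega), entry_potential _ (by omega)]
    simp only [interpolation]
    push_cast
    ring
  refine h1.trans ?_
  rw [sum_mul_second_difference, entry_zero, entry_of_lt 0 0 _ n.lt_succ_self,
    Finset.sum_congr rfl h2, Finset.sum_add_distrib, Finset.sum_sub_distrib, ← Finset.mul_sum,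
    Finset.sum_range_sub (fun j => ((entry β₀ β₁ p.1 j : ℤ) : ℚ)), entry_zero,
    entry_of_lt β₀ β₁ _ n.lt_succ_self]
  simp only [Finset.sum_const, Finset.card_range, nsmul_eq_mul]
  push_cast
  field_simp
  ring

end Solution

/-! ### Sums over boxes as iterated sums over chains -/

/-- The vectors with all entries in `[0, B]`. -/
def box (n : ℕ) (B : ℤ) : Finset (Fin n → ℤ) := Fintype.piFinset fun _ => Finset.Icc 0 B

theorem mem_box {n : ℕ} {B : ℤ} {m : Fin n → ℤ} : m ∈ box n B ↔ ∀ k, 0 ≤ m k ∧ m k ≤ B := by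
  simp [box]

theorem sum_box_snoc {n : ℕ} (B : ℤ) (f : (Fin (n + 1) → ℤ) → ℂ) :
    ∑ m ∈ box (n + 1) B, f m = ∑ a ∈ Finset.Icc 0 B, ∑ m ∈ box n B,
      f (Fin.snoc (α := fun _ => ℤ) m a) := by
  rw [← Finset.sum_product']
  refine Finset.sum_nbij' (fun m => (m (Fin.last n), Fin.init m))
    (fun x => Fin.snoc (α := fun _ => ℤ) x.2 x.1) ?_ ?_ ?_ ?_ ?_
  · intro m hm
    rw [mem_box] at hm
    rw [Finset.mem_product, Finset.mem_Icc, mem_box]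
    exact ⟨hm _, fun k => hm _⟩
  · rintro ⟨a, m⟩ h
    rw [Finset.mem_product, Finset.mem_Icc, mem_box] at h
    rw [mem_box]
    intro k
    refine Fin.lastCases ?_ (fun k => ?_) k
    · rw [Fin.snoc_last]; exact h.1
    · rw [Fin.snoc_castSucc]; exact h.2 k
  · intro m _; simp
  · intro x _; simp
  · intro m _; simp

theorem sum_box_cons {n : ℕ} (B : ℤ) (f : (Fin (n + 1) → ℤ) → ℂ) :
    ∑ m ∈ box (n + 1) B, f m = ∑ a ∈ Finset.Icc 0 B, ∑ m ∈ box n B,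
      f (Fin.cons (α := fun _ => ℤ) a m) := by
  rw [← Finset.sum_product']
  refine Finset.sum_nbij' (fun m => (m 0, Fin.tail m))
    (fun x => Fin.cons (α := fun _ => ℤ) x.1 x.2) ?_ ?_ ?_ ?_ ?_
  · intro m hm
    rw [mem_box] at hm
    rw [Finset.mem_product, Finset.mem_Icc, mem_box]
    exact ⟨hm _, fun k => hm _⟩
  · rintro ⟨a, m⟩ h
    rw [Finset.mem_product, Finset.mem_Icc, mem_box] at h
    rw [mem_box]
    intro k
    refine Fin.cases ?_ (fun k => ?_) k
    · rw [Fin.cons_zero]; exact h.1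
    · rw [Fin.cons_succ]; exact h.2 k
  · intro m _; simp
  · intro x _; simp
  · intro m _; simp

theorem sum_box_zero (B : ℤ) (f : (Fin 0 → ℤ) → ℂ) : ∑ m ∈ box 0 B, f m = f ![] := by
  have h : box 0 B = {![]} := by
    ext m
    simp only [mem_box, Finset.mem_singleton, IsEmpty.forall_iff, true_iff]
    exact Subsingleton.elim _ _
  rw [h, Finset.sum_singleton]

/-- The weight of a chain `e 0, …, e (n + 1)`. -/
def chainWeight (q w : ℂ) (n : ℕ) (e : ℕ → ℤ) : ℂ :=
  (∏ k ∈ Finset.range n, halfGauss q (e k + e (k + 2)) (e (k + 1))) *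
    ∏ j ∈ Finset.range (n + 1), quarterSq w (e j - e (j + 1))

theorem chainWeight_congr {q w : ℂ} {n : ℕ} {e e' : ℕ → ℤ} (h : ∀ j ≤ n + 1, e j = e' j) :
    chainWeight q w n e = chainWeight q w n e' := by
  rw [chainWeight, chainWeight]
  congr 1
  · refine Finset.prod_congr rfl fun k hk => ?_
    rw [Finset.mem_range] at hk
    rw [h k (by omega), h (k + 1) (by omega), h (k + 2) (by omega)]
  · refine Finset.prod_congr rfl fun k hk => ?_
    rw [Finset.mem_range] at hk
    rw [h k (by omega), h (k + 1) (by omega)]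

theorem chainWeight_succ (q w : ℂ) (n : ℕ) (e : ℕ → ℤ) :
    chainWeight q w (n + 1) e = chainWeight q w n e *
      (halfGauss q (e n + e (n + 2)) (e (n + 1)) * quarterSq w (e (n + 1) - e (n + 2))) := by
  rw [chainWeight, chainWeight, Finset.prod_range_succ, Finset.prod_range_succ _ (n + 1)]
  ring

theorem chainWeight_succ' (q w : ℂ) (n : ℕ) (e : ℕ → ℤ) :
    chainWeight q w (n + 1) e = halfGauss q (e 0 + e 2) (e 1) * quarterSq w (e 0 - e 1) *
      chainWeight q w n (fun j => e (j + 1)) := by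
  rw [chainWeight, chainWeight, Finset.prod_range_succ', Finset.prod_range_succ' _ (n + 1)]
  ring

/-- A sum over chains, built up from the left. -/
theorem sum_chainWeight_left {q w : ℂ} {B x β : ℤ} (hx : 0 ≤ x) (hxB : x ≤ B) (hβ : 0 ≤ β)
    (hβB : β ≤ B) (n : ℕ) (b : ℤ) (T : ℤ → ℂ) :
    ∑ m ∈ box n B, halfGauss q (x + entry β b m 1) β * T (entry β b m n) *
        chainWeight q w n (entry β b m) =
      ∑ z ∈ Finset.Icc 0 B, ∑ u ∈ Finset.Icc 0 B, (stepLeft q w B)^[n] (leftEnd x β) z u *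
        (halfGauss q (z + b) u * quarterSq w (u - b) * T u) := by
  induction n generalizing b T with
  | zero =>
    rw [sum_box_zero, Finset.sum_eq_single_of_mem x (by simp [hx, hxB]),
      Finset.sum_eq_single_of_mem β (by simp [hβ, hβB])]
    · simp only [Function.iterate_zero, id_eq, leftEnd, entry_zero, chainWeight,
        Finset.prod_range_zero, Finset.prod_range_one, zero_add,
        entry_of_lt β b ![] zero_lt_one, and_self, if_true]
      ring
    · intro u _ hu
      simp [leftEnd, hu]
    · intro z _ hz
      simp [leftEnd, hz]
  | succ n ih =>
    have h1 : ∀ a ∈ Finset.Icc 0 B, ∑ m ∈ box n B,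
        halfGauss q (x + entry β b (Fin.snoc (α := fun _ => ℤ) m a) 1) β *
          T (entry β b (Fin.snoc (α := fun _ => ℤ) m a) (n + 1)) *
          chainWeight q w (n + 1) (entry β b (Fin.snoc (α := fun _ => ℤ) m a)) =
        (∑ z ∈ Finset.Icc 0 B, ∑ u ∈ Finset.Icc 0 B, (stepLeft q w B)^[n] (leftEnd x β) z u *
        (halfGauss q (z + a) u * quarterSq w (u - a) * halfGauss q (u + b) a)) *
          (quarterSq w (a - b) * T a) := by
      intro a _
      rw [← ih a fun y => halfGauss q (y + b) a, Finset.sum_mul]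
      refine Finset.sum_congr rfl fun m _ => ?_
      rw [chainWeight_succ, chainWeight_congr fun j hj => entry_snoc β b m hj,
        entry_snoc β b m (by omega : 1 ≤ n + 1), entry_snoc β b m (by omega : n ≤ n + 1),
        entry_snoc β b m le_rfl, entry_of_lt β a m n.lt_succ_self, entry_of_lt β b _ (by omega)]
      ring
    rw [sum_box_snoc, Finset.sum_congr rfl h1]
    symm
    rw [Finset.sum_comm]
    refine Finset.sum_congr rfl fun a _ => ?_
    rw [Finset.sum_comm, Finset.sum_mul]
    refine Finset.sum_congr rfl fun u _ => ?_
    rw [Function.iterate_succ_apply', stepLeft, Finset.sum_mul, Finset.sum_mul]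
    exact Finset.sum_congr rfl fun z _ => by ring

/-- A sum over chains ending in `0`, built up from the right. -/
theorem sum_chainWeight_right {q w : ℂ} {B : ℤ} (hB : 0 ≤ B) (n : ℕ) (β : ℤ) (T : ℤ → ℂ) :
    ∑ m ∈ box n B, T (entry β 0 m 1) * chainWeight q w n (entry β 0 m) =
      ∑ v ∈ Finset.Icc 0 B, T v * (quarterSq w (β - v) *
        (stepRight q w B)^[n] rightEnd β v) := by
  induction n generalizing β T with
  | zero =>
    rw [sum_box_zero, Finset.sum_eq_single_of_mem 0 (by simpa using hB)]
    · simp [chainWeight, rightEnd, entry_of_lt β (0 : ℤ) ![] zero_lt_one]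
    · intro v _ hv
      simp [rightEnd, hv]
  | succ n ih =>
    rw [sum_box_cons]
    refine Finset.sum_congr rfl fun a _ => ?_
    rw [Function.iterate_succ_apply', stepRight]
    have h := ih a fun v => halfGauss q (β + v) a
    simp only [← mul_assoc] at h
    rw [← h, Finset.mul_sum, Finset.mul_sum]
    refine Finset.sum_congr rfl fun m _ => ?_
    rw [chainWeight_succ', chainWeight_congr fun j _ => entry_cons β (0 : ℤ) m j, entry_zero,
      entry_cons β (0 : ℤ) m 0, entry_cons β (0 : ℤ) m 1, entry_zero]
    ring

/-! ### From sums over solutions to sums of chain weights -/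

section Solution

variable {n : ℕ} {β₀ β₁ : ℤ}

theorem mem_solutions_iff {b : Fin (n + 1 - 1) → ℤ} {r : ℚ} {p : (Fin n → ℤ) × (Fin n → ℤ)}
    (hb : b = β₀ • unitVec (n + 1) 1 + β₁ • unitVec (n + 1) (n + 1 - 1)) :
    p ∈ solutions (n + 1) b r ↔ ChainSystem β₀ β₁ p ∧
      ∃ k : ℤ, r + (interpolation n β₀ β₁ 1 - entry β₀ β₁ p.1 1) / 2 = k := by
  have h : 2 • (p.1 + p.2) = incidence (n + 1) *ᵥ p.1 + b ↔ ChainSystem β₀ β₁ p := by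
    rw [hb, funext_iff]
    refine forall_congr' fun k => ?_
    rw [incidence_mulVec β₀ β₁ p.1 k, Pi.smul_apply, nsmul_eq_mul]
    rfl
  constructor
  · rintro ⟨h1, h2⟩
    have h3 := h.1 h1
    rw [cartanInvFirst_eq h3] at h2
    exact ⟨h3, h2⟩
  · rintro ⟨h1, h2⟩
    rw [← cartanInvFirst_eq h1] at h2
    exact ⟨h.2 h1, h2⟩

theorem nonneg_of_qBinomVec_ne_zero {q : ℂ} {p : (Fin n → ℤ) × (Fin n → ℤ)}
    (h : qBinomVec q (N := n + 1) p.1 p.2 ≠ 0) (k : Fin n) : 0 ≤ p.1 k ∧ 0 ≤ p.2 k := by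
  have h1 := of_qBinom_ne_zero (Finset.prod_ne_zero_iff.1 h k (Finset.mem_univ k))
  obtain ⟨-, -, h2, h3⟩ := h1
  exact ⟨by exact_mod_cast (le_add_iff_nonneg_left _).1 h3, by exact_mod_cast h2⟩

theorem entry_nonneg {m : Fin n → ℤ} (h0 : 0 ≤ β₀) (h1 : 0 ≤ β₁) (hm : ∀ k, 0 ≤ m k) (j : ℕ) :
    0 ≤ entry β₀ β₁ m j := by
  unfold entry
  split_ifs
  exacts [h0, hm _, h1]

theorem qBinomVec_eq {q : ℂ} (hq : ∀ k : ℕ, 0 < k → q ^ k ≠ 1) {p : (Fin n → ℤ) × (Fin n → ℤ)}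
    (h0 : 0 ≤ β₀) (h1 : 0 ≤ β₁) (hp : ChainSystem β₀ β₁ p) (hm : ∀ k, 0 ≤ p.1 k) :
    qBinomVec q (N := n + 1) p.1 p.2 = ∏ k ∈ Finset.range n,
      halfGauss q (entry β₀ β₁ p.1 k + entry β₀ β₁ p.1 (k + 2)) (entry β₀ β₁ p.1 (k + 1)) := by
  rw [Finset.prod_range]
  refine Finset.prod_congr rfl fun (k : Fin n) _ => ?_
  have h2 := entry_nonneg h0 h1 hm k
  have h3 := entry_nonneg h0 h1 hm (k + 2)
  have h4 := hp k
  -- Symmetry of the q-binomial exchanges the bottom entry n_k for m_k, so that only the chain m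
  -- remains.
  rw [entry_fin_succ, halfGauss_two_mul q (p.1 k + p.2 k) _ h4.symm, ← Int.cast_add,
    qBinom_intCast hq (by omega), ← gauss_symm hq (by omega), add_sub_cancel_right]

theorem le_of_qBinomVec_ne_zero {q : ℂ} {p : (Fin n → ℤ) × (Fin n → ℤ)} {B : ℤ}
    (h0 : β₀ ≤ B) (h1 : β₁ ≤ B) (hp : ChainSystem β₀ β₁ p)
    (h : qBinomVec q (N := n + 1) p.1 p.2 ≠ 0) (k : Fin n) : p.1 k ≤ B := by
  have h2 := le_of_convex (e := entry β₀ β₁ p.1) (n := n) (B := B) (by simpa using h0)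
    (by rwa [entry_of_lt _ _ _ n.lt_succ_self]) ?_ (k + 1) (by omega)
  · rwa [entry_fin_succ] at h2
  · intro j hj
    have h3 := hp ⟨j, hj⟩
    have h4 := nonneg_of_qBinomVec_ne_zero h ⟨j, hj⟩
    rw [entry_succ _ _ _ hj]
    simp only at h3
    omega

theorem qPow_cartanInvForm {w : ℂ} {p : (Fin n → ℤ) × (Fin n → ℤ)} (hp : ChainSystem β₀ β₁ p) :
    qPow w (cartanInvForm (n + 1) p.2) = qPow w (-((β₁ - β₀ : ℚ) ^ 2 / (4 * (n + 1)))) *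
      ∏ j ∈ Finset.range (n + 1),
        quarterSq w (entry β₀ β₁ p.1 j - entry β₀ β₁ p.1 (j + 1)) := by
  rw [cartanInvForm_eq hp, sub_eq_neg_add, qPow_add]
  congr 1
  induction Finset.range (n + 1) using Finset.induction_on with
  | empty => simp [qPow]
  | insert a s ha ih => rw [Finset.sum_insert ha, Finset.prod_insert ha, qPow_add, ih, quarterSq]

/-- The sums over solutions of the linear system are sums of chain weights. -/
theorem finsum_solutions {q w : ℂ} (hq : ∀ k : ℕ, 0 < k → q ^ k ≠ 1) {B : ℤ}
    {r : ℚ} {S : Set ((Fin n → ℤ) × (Fin n → ℤ))}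
    (hS : ∀ p, p ∈ S ↔ ChainSystem β₀ β₁ p ∧
      ∃ k : ℤ, r + (interpolation n β₀ β₁ 1 - entry β₀ β₁ p.1 1) / 2 = k)
    (h0 : 0 ≤ β₀) (h1 : 0 ≤ β₁) (h0B : β₀ ≤ B) (h1B : β₁ ≤ B)
    (f : (Fin n → ℤ) × (Fin n → ℤ) → ℂ) (T : (Fin n → ℤ) → ℂ) (T' : (Fin n → ℤ) → ℂ)
    (hf : ∀ p, f p = qPow w (cartanInvForm (n + 1) p.2) * qBinomVec q (N := n + 1) p.1 p.2 * T p.1)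
    (hT : ∀ m ∈ box n B, T m = T' m)
    (hr : ∀ m, T m ≠ 0 → ∃ k : ℤ, r + (interpolation n β₀ β₁ 1 - entry β₀ β₁ m 1) / 2 = k) :
    {p ∈ S | f p ≠ 0}.Finite ∧
    ∑ᶠ p ∈ S, f p = qPow w (-((β₁ - β₀ : ℚ) ^ 2 / (4 * (n + 1)))) *
      ∑ m ∈ box n B, T' m * chainWeight q w n (entry β₀ β₁ m) := by
  have hval : ∀ p, ChainSystem β₀ β₁ p → p.1 ∈ box n B →
      f p = qPow w (-((β₁ - β₀ : ℚ) ^ 2 / (4 * (n + 1)))) *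
        (T' p.1 * chainWeight q w n (entry β₀ β₁ p.1)) := by
    intro p hp hm
    rw [hf, hT _ hm, qPow_cartanInvForm hp,
      qBinomVec_eq hq h0 h1 hp fun k => (mem_box.1 hm k).1, chainWeight]
    ring
  have hbox : ∀ p, ChainSystem β₀ β₁ p → f p ≠ 0 → p.1 ∈ box n B := by
    intro p hp hne
    rw [hf] at hne
    have h2 := right_ne_zero_of_mul (left_ne_zero_of_mul hne)
    exact mem_box.2 fun k =>
      ⟨(nonneg_of_qBinomVec_ne_zero h2 k).1, le_of_qBinomVec_ne_zero h0B h1B hp h2 k⟩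
  set g : (Fin n → ℤ) → ℂ := fun m => qPow w (-((β₁ - β₀ : ℚ) ^ 2 / (4 * (n + 1)))) *
        (T' m * chainWeight q w n (entry β₀ β₁ m)) with hg
  have hbij : Set.BijOn Prod.fst {p ∈ S | f p ≠ 0}
      ((box n B : Set (Fin n → ℤ)) ∩ Function.support g) := by
    refine ⟨?_, ?_, ?_⟩
    · rintro p ⟨hp, hne⟩
      have hp := ((hS _).1 hp).1
      have hm := hbox p hp hne
      refine ⟨hm, ?_⟩
      rw [hval p hp hm] at hne
      exact hne
    · rintro p ⟨hp, -⟩ p' ⟨hp', -⟩ h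
      have hp := ((hS _).1 hp).1
      have hp' := ((hS _).1 hp').1
      refine Prod.ext h (funext fun k => ?_)
      have h2 := hp k
      have h3 := hp' k
      rw [h] at h2
      omega
    · rintro m ⟨hm, hne⟩
      have h2 := left_ne_zero_of_mul (right_ne_zero_of_mul (right_ne_zero_of_mul hne))
      -- A nonzero chain weight forces e_k + e_{k+2} to be even, so the n solving the system is
      -- integral; the restriction then follows from `hr`.
      have hp : ChainSystem β₀ β₁
          (m, fun k : Fin n => (entry β₀ β₁ m k + entry β₀ β₁ m (k + 2)) / 2 - m k) := by
        intro k
        have := even_of_halfGauss_ne_zero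
          (Finset.prod_ne_zero_iff.1 h2 k (Finset.mem_range.2 k.2))
        simp only
        omega
      have hne' : f (m, fun k : Fin n => (entry β₀ β₁ m k + entry β₀ β₁ m (k + 2)) / 2 - m k) ≠ 0 := by
        rw [hval _ hp hm]
        exact hne
      refine ⟨_, ⟨(hS _).2 ⟨hp, hr m ?_⟩, hne'⟩, rfl⟩
      rw [hf] at hne'
      exact right_ne_zero_of_mul hne'
  constructor
  · exact Set.Finite.of_finite_image (by
      rw [hbij.image_eq]; exact (box n B).finite_toSet.inter_of_left _) hbij.injOn
  · rw [← finsum_mem_inter_support, Finset.mul_sum]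
    refine (finsum_mem_eq_of_bijOn (g := g) Prod.fst hbij ?_).trans ?_
    rotate_left
    · rw [finsum_mem_inter_support, finsum_mem_coe_finset]
    · rintro p ⟨hp, hne⟩
      have hp := ((hS _).1 hp).1
      exact hval p hp (hbox p hp hne)

end Solution

/-! ### The two sides of the formula as chain sums -/

theorem lhsTerm_finsum {q w : ℂ} (hq : ∀ k : ℕ, 0 < k → q ^ k ≠ 1) {n : ℕ} {σ l i X Y B k₁ : ℤ}
    {L₁ L₂ : ℚ} (hk₁ : L₁ + (l + σ : ℚ) / 2 = k₁) (hY : L₁ = (Y : ℚ) / 2)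
    (hX : L₂ = ((X - l : ℤ) : ℚ) / 2) (hY0 : 0 ≤ Y) (hX0 : 0 ≤ X - l) (hi : 0 ≤ i)
    (hil : 0 ≤ i + l) (hB : 2 * i + l ≤ B) :
    {p ∈ lhsIndex (n + 1) σ l i | lhsTerm q w (n + 1) l i L₁ L₂ p ≠ 0}.Finite ∧
    ∑ᶠ p ∈ lhsIndex (n + 1) σ l i, lhsTerm q w (n + 1) l i L₁ L₂ p =
      qPow w (-((2 * i + l : ℚ) ^ 2 / (4 * (n + 1)))) *
        ∑ v ∈ Finset.Icc 0 B, halfGauss q (Y + v) (i + l) * halfGauss q (X - l + v) i *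
          (quarterSq w (2 * i + l - v) * (stepRight q w B)^[n] rightEnd (2 * i + l) v) := by
  have hn : (n : ℚ) + 1 ≠ 0 := by positivity
  have h := finsum_solutions (q := q) (w := w) hq (n := n) (β₀ := 2 * i + l) (β₁ := 0) (B := B)
    (r := (2 * i + l + σ * (n + 1 : ℕ) : ℚ) / (2 * (n + 1 : ℕ)))
    (S := lhsIndex (n + 1) σ l i)
    (fun p => mem_solutions_iff (by rw [zero_smul, add_zero])) (by omega) le_rfl hB (by omega)
    (lhsTerm q w (n + 1) l i L₁ L₂)
    (fun m => qBinom q (L₁ + ((entry (2 * i + l) 0 m 1 : ℤ) : ℚ) / 2) (i + l) *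
      qBinom q (L₂ + ((entry (2 * i + l) 0 m 1 : ℤ) : ℚ) / 2) i)
    (fun m => halfGauss q (Y + entry (2 * i + l) 0 m 1) (i + l) *
      halfGauss q (X - l + entry (2 * i + l) 0 m 1) i)
    -- `comp` and `entry` unfold to the same expression, so only the bracketing of the summand
    -- changes.
    (fun p => mul_assoc _ _ _) ?_ ?_
  · refine ⟨h.1, h.2.trans ?_⟩
    rw [sum_chainWeight_right (q := q) (w := w) (by omega : 0 ≤ B) n (2 * i + l)
      (fun e => halfGauss q (Y + e) (i + l) * halfGauss q (X - l + e) i)]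
    congr 2
    push_cast
    ring
  · intro m hm
    have he := entry_nonneg (β₀ := 2 * i + l) (β₁ := 0) (by omega) le_rfl
      (fun k => (mem_box.1 hm k).1) 1
    rw [qBinom_eq_halfGauss hq (x := Y + entry (2 * i + l) 0 m 1) (b := i + l)
        (by rw [hY]; push_cast; ring) (by push_cast; ring) (by omega),
      qBinom_eq_halfGauss hq (x := X - l + entry (2 * i + l) 0 m 1) (b := i)
        (by rw [hX]; push_cast; ring) rfl (by omega)]
  · intro m hm
    have h1 := (of_qBinom_ne_zero (left_ne_zero_of_mul hm)).1
    rw [Rat.den_eq_one_iff] at h1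
    -- The terms with denominator N cancel, and the restriction becomes integrality of i + (l + σ)/2
    -- - m_1/2. This is i + k₁ minus the integral top entry L₁ + m_1/2.
    refine ⟨i + k₁ - (L₁ + ((entry (2 * i + l) 0 m 1 : ℤ) : ℚ) / 2).num, ?_⟩
    rw [Int.cast_sub, Int.cast_add, h1, ← hk₁, interpolation]
    push_cast
    field_simp
    ring

theorem rhsTerm_finsum {q w : ℂ} (hq : ∀ k : ℕ, 0 < k → q ^ k ≠ 1) {n : ℕ} {σ l M X Y B k₁ : ℤ}
    {L₁ L₂ : ℚ} (hk₁ : L₁ + (l + σ : ℚ) / 2 = k₁) (hY : L₁ = (Y : ℚ) / 2)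
    (hX : L₂ = ((X - l : ℤ) : ℚ) / 2) (hY0 : 0 ≤ Y) (hX0 : 0 ≤ X - l) (hM : 0 ≤ M)
    (hMl : 0 ≤ M + l) (hMB : M ≤ B) (hMlB : M + l ≤ B) (hYB : Y + M ≤ B) :
    {p ∈ rhsIndex (n + 1) σ l M | rhsTerm q w (n + 1) l M L₁ L₂ p ≠ 0}.Finite ∧
    ∑ᶠ p ∈ rhsIndex (n + 1) σ l M, rhsTerm q w (n + 1) l M L₁ L₂ p =
      qPow w (-((l : ℚ) ^ 2 / (4 * (n + 1)))) *
        closedSum q w B X M ((stepLeft q w B)^[n] (leftEnd (Y + M) (M + l))) := by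
  have hn : (n : ℚ) + 1 ≠ 0 := by positivity
  have h := finsum_solutions (q := q) (w := w) hq (n := n) (β₀ := M + l) (β₁ := M) (B := B)
    (r := (l + σ * (n + 1 : ℕ) : ℚ) / (2 * (n + 1 : ℕ)))
    (S := rhsIndex (n + 1) σ l M)
    (fun p => mem_solutions_iff rfl) hMl hM hMlB hMB
    (rhsTerm q w (n + 1) l M L₁ L₂)
    (fun m => qBinom q (L₁ + (M + ((entry (M + l) M m 1 : ℤ) : ℚ)) / 2) (M + l) *
      qBinom q (L₂ + (M + l + ((entry (M + l) M m n : ℤ) : ℚ)) / 2) M)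
    (fun m => halfGauss q (Y + M + entry (M + l) M m 1) (M + l) *
      halfGauss q (X + M + entry (M + l) M m n) M)
    (fun p => mul_assoc _ _ _) ?_ ?_
  · refine ⟨h.1, h.2.trans ?_⟩
    rw [sum_chainWeight_left (q := q) (w := w) (by omega) hYB hMl hMlB n M
      (fun e => halfGauss q (X + M + e) M)]
    congr 2
    push_cast
    ring
  · intro m hm
    have he := entry_nonneg (β₀ := M + l) (β₁ := M) hMl hM (fun k => (mem_box.1 hm k).1)
    have he1 := he 1
    have hen := he n
    rw [qBinom_eq_halfGauss hq (x := Y + M + entry (M + l) M m 1) (b := M + l)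
        (by rw [hY]; push_cast; ring) (by push_cast; ring) (by omega),
      qBinom_eq_halfGauss hq (x := X + M + entry (M + l) M m n) (b := M)
        (by rw [hX]; push_cast; ring) rfl (by omega)]
  · intro m hm
    have h1 := (of_qBinom_ne_zero (left_ne_zero_of_mul hm)).1
    rw [Rat.den_eq_one_iff] at h1
    refine ⟨M + k₁ - (L₁ + (M + ((entry (M + l) M m 1 : ℤ) : ℚ)) / 2).num, ?_⟩
    rw [Int.cast_sub, Int.cast_add, h1, ← hk₁, interpolation]
    push_cast
    field_simp
    ring

theorem lhsTerm_eq_zero (q w : ℂ) (N : ℕ) {l i : ℤ} (L₁ L₂ : ℚ) (h : i + l < 0)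
    (p : (Fin (N - 1) → ℤ) × (Fin (N - 1) → ℤ)) : lhsTerm q w N l i L₁ L₂ p = 0 := by
  rw [lhsTerm, qBinom_of_neg (b := (i + l : ℚ)) q _ (by exact_mod_cast h), mul_zero, zero_mul]

theorem rhsTerm_eq_zero (q w : ℂ) (N : ℕ) {l M : ℤ} (L₁ L₂ : ℚ) (h : M < 0 ∨ M + l < 0)
    (p : (Fin (N - 1) → ℤ) × (Fin (N - 1) → ℤ)) : rhsTerm q w N l M L₁ L₂ p = 0 := by
  rcases h with h | h
  · rw [rhsTerm, qBinom_of_neg (b := (M : ℚ)) q _ (by exact_mod_cast h), mul_zero]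
  · rw [rhsTerm, qBinom_of_neg (b := (M + l : ℚ)) q _ (by exact_mod_cast h), mul_zero, zero_mul]

end QSaal

end

/-! ### Assembly -/

theorem theorem2p1 (q w : ℂ) (hw : Complex.exp w = q) (hq : ∀ k : ℕ, 0 < k → q ^ k ≠ 1)
    (σ : ℤ) (hσ : σ = 0 ∨ σ = 1) (N : ℕ) (hN : 1 ≤ N) (l M : ℤ) (L₁ L₂ : ℚ)
    (hL₁ : 0 ≤ L₁) (hL₂ : 0 ≤ L₂)
    (hi₁ : ∃ k : ℤ, L₁ + (l + σ : ℚ) / 2 = k) (hi₂ : ∃ k : ℤ, L₂ + (l + σ : ℚ) / 2 = k)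
    (hpar : Even (l + σ * N)) :
    -- the sums over the integer vectors have only finitely many nonzero terms
    (∀ i ∈ Finset.Icc 0 M,
      {p ∈ QSaal.lhsIndex N σ l i | QSaal.lhsTerm q w N l i L₁ L₂ p ≠ 0}.Finite) ∧
    {p ∈ QSaal.rhsIndex N σ l M | QSaal.rhsTerm q w N l M L₁ L₂ p ≠ 0}.Finite ∧
    -- the summation formula
    ∑ i ∈ Finset.Icc 0 M,
        QSaal.qPow w ((i * (i + l) : ℚ) / N) * QSaal.qBinom q (L₁ + L₂ + M - i) (M - i) *
          ∑ᶠ p ∈ QSaal.lhsIndex N σ l i, QSaal.lhsTerm q w N l i L₁ L₂ p =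
      ∑ᶠ p ∈ QSaal.rhsIndex N σ l M, QSaal.rhsTerm q w N l M L₁ L₂ p := by
  obtain ⟨n, rfl⟩ := Nat.exists_eq_add_of_le' hN
  obtain ⟨k₁, hk₁⟩ := hi₁
  obtain ⟨k₂, hk₂⟩ := hi₂
  obtain ⟨Y, hY⟩ : ∃ Y : ℤ, L₁ = (Y : ℚ) / 2 :=
    ⟨2 * k₁ - l - σ, by push_cast; linarith⟩
  obtain ⟨X, hX⟩ : ∃ X : ℤ, L₂ = ((X - l : ℤ) : ℚ) / 2 :=
    ⟨2 * k₂ - σ, by push_cast; linarith⟩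
  have hY0 : 0 ≤ Y := by
    rw [hY] at hL₁; exact_mod_cast (by linarith : (0 : ℚ) ≤ (Y : ℚ))
  have hX0 : 0 ≤ X - l := by
    rw [hX] at hL₂; exact_mod_cast (by linarith : (0 : ℚ) ≤ ((X - l : ℤ) : ℚ))
  by_cases hM : M < 0 ∨ M + l < 0
  · have hr := QSaal.rhsTerm_eq_zero q w (n + 1) L₁ L₂ hM
    have hl : ∀ i ∈ Finset.Icc 0 M, ∀ p, QSaal.lhsTerm q w (n + 1) l i L₁ L₂ p = 0 := by
      intro i hi
      rw [Finset.mem_Icc] at hi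
      exact QSaal.lhsTerm_eq_zero q w (n + 1) L₁ L₂ (by omega)
    refine ⟨fun i hi => by simp [hl i hi], by simp [hr], ?_⟩
    rw [Finset.sum_eq_zero fun i hi => by simp [hl i hi]]
    simp [hr]
  obtain ⟨hM0, hMl⟩ : 0 ≤ M ∧ 0 ≤ M + l := by omega
  -- One bound for every box: it dominates the end values Y + M, M + l, M and 2i + l, and the bound
  -- X + nX + M of the moving argument, where X may be negative.
  obtain ⟨B, hB⟩ : ∃ B : ℤ, B = Y + 2 * M + (M + l) + (n + 1) * |X| := ⟨_, rfl⟩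
  have hB0 : 0 ≤ ((n : ℤ) + 1) * |X| := by positivity
  have hXB : X + n * X + M ≤ B := by
    have : ((n : ℤ) + 1) * X ≤ (n + 1) * |X| :=
      mul_le_mul_of_nonneg_left (le_abs_self X) (by positivity)
    linarith
  have hR := QSaal.rhsTerm_finsum (w := w) hq (n := n) (B := B) hk₁ hY hX hY0 hX0 hM0 hMl
    (by omega) (by omega) (by omega)
  have hchain := QSaal.chain_identity hw hq (B := B) n (by omega : l ≤ X) hY0 hM0 hMl (by omega)
    (by omega) hXB
  refine ⟨fun i hi => ?_, hR.1, ?_⟩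
  · rw [Finset.mem_Icc] at hi
    rcases lt_or_ge (i + l) 0 with hil | hil
    · simp [QSaal.lhsTerm_eq_zero q w (n + 1) L₁ L₂ hil]
    · exact (QSaal.lhsTerm_finsum (w := w) hq (B := B) hk₁ hY hX hY0 hX0 hi.1 hil (by omega)).1
  rw [hR.2, ← hchain, Finset.mul_sum]
  refine Finset.sum_congr rfl fun i hi => ?_
  rw [Finset.mem_Icc] at hi
  rcases lt_or_ge (i + l) 0 with hil | hil
  · have h0 : ∀ x, QSaal.halfGauss q x (i + l) = 0 := fun x => by
      by_contra h
      have := QSaal.nonneg_of_halfGauss_ne_zero h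
      omega
    simp [QSaal.lhsTerm_eq_zero q w (n + 1) L₁ L₂ hil, h0]
  · have hn : (n : ℚ) + 1 ≠ 0 := by positivity
    rw [(QSaal.lhsTerm_finsum (w := w) hq (B := B) hk₁ hY hX hY0 hX0 hi.1 hil (by omega)).2,
      QSaal.qBinom_eq_halfGauss hq (x := Y + (X - l) + 2 * (M - i)) (b := M - i)
        (by rw [hY, hX]; push_cast; ring) (by push_cast; ring) (by omega)]
    -- Since (2i + l)² - 4i(i + l) = l², the prefactor q^{i(i+l)/N} cancels the dependence on i of
    -- the boundary term of the quadratic form.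
    have hexp : QSaal.qPow w ((i * (i + l) : ℚ) / (n + 1 : ℕ)) *
        QSaal.qPow w (-((2 * i + l : ℚ) ^ 2 / (4 * (n + 1)))) =
        QSaal.qPow w (-((l : ℚ) ^ 2 / (4 * (n + 1)))) := by
      rw [← QSaal.qPow_add]
      congr 1
      push_cast
      field_simp
      ring
    rw [← hexp]
    ring
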